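/- Let $n \ge 1$. The Latin square graph $\mathrm{LS}(\mathbb{Z}_n)$ of the cyclic group $\mathbb{Z}_n$ has vertex set $\mathbb{Z}_n \times \mathbb{Z}_n$, and two distinct vertices $(r,c)$ and $(r',c')$ are adjacent if and only if $r=r'$, $c=c'$ or $r+c=r'+c'$. For a finite simple graph $G$ and a partition $\mathcal{P}$ of $V(G)$, the quotient $G/\mathcal{P}$ has the parts of $\mathcal{P}$ as its vertices; two distinct parts $U,W$ are joined by a black edge if all pairs in $U\times W$ are edges of $G$, are not adjacent if no such pair is an edge of $G$, and are joined by a red edge otherwise. Let $\Delta_{\mathrm{red}}(G/\mathcal{P})$ be the maximum number of red edges at a vertex of $G/\mathcal{P}$. With $N=|V(G)|$, a partition sequence of $G$ is a sequence $\mathcal{P}_N,\dots,\mathcal{P}_1$ of partitions of $V(G)$ in which $\mathcal{P}_N$ is the partition into singletons and each $\mathcal{P}_i$ with $i<N$ arises from $\mathcal{P}_{i+1}$ by replacing two distinct parts by their union. The twin-width $\mathrm{tww}(G)$ is the minimum over all partition sequences of $\max_i \Delta_{\mathrm{red}}(G/\mathcal{P}_i)$. If $N\ge 2$, let $\mathrm{lb}_1(G)$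 be the minimum of $\Delta_{\mathrm{red}}(G/\mathcal{P}_{N-1})$ over all partitions $\mathcal{P}_{N-1}$ that arise from the partition into singletons by merging one pair of vertices; if $N = 1$, let $\mathrm{lb}_1(G)=0$. The graph $G$ is called $\mathrm{lb}_1$-collapsible if $\mathrm{tww}(G)=\mathrm{lb}_1(G)$. **Theorem.** For every $n\ge 1$, the graph $\mathrm{LS}(\mathbb{Z}_n)$ is $\mathrm{lb}_1$-collapsible. Moreover, $\mathrm{tww}(\mathrm{LS}(\mathbb{Z}_4))=6$, and $\mathrm{tww}(\mathrm{LS}(\mathbb{Z}_n))=4n-8$ for every $n\ge 5$. -/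

import Mathlib

/-! ### Trigraphs, quotients and red degrees -/

/-- A trigraph: a finite simple graph whose edges are coloured black or red. -/
structure Trigraph (V : Type*) where
  /-- the graph of black edges -/
  black : SimpleGraph V
  /-- the graph of red edges -/
  red : SimpleGraph V
  /-- no edge has both colours -/
  disjoint : Disjoint black red

/-- A graph as a trigraph: all edges are black. -/
def SimpleGraph.toTrigraph {V : Type*} (G : SimpleGraph V) : Trigraph V where
  black := G
  red := ⊥
  disjoint := disjoint_bot_right

namespace Trigraph

/-- The red degree of a vertex: the number of red edges incident to it. -/
noncomputable def redDegree {V : Type*} (G : Trigraph V) (v : V) : ℕ :=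
  (G.red.neighborSet v).ncard

/-- The maximum red degree (`0` if there are no vertices). -/
noncomputable def maxRedDegree {V : Type*} [Fintype V] (G : Trigraph V) : ℕ :=
  Finset.univ.sup G.redDegree

/-- All pairs between `U` and `W` are black edges. -/
def FullyConnected {V : Type*} (G : Trigraph V) (U W : Finset V) : Prop :=
  ∀ u ∈ U, ∀ w ∈ W, G.black.Adj u w

/-- No pair between `U` and `W` is an edge, of either colour. -/
def Disconnected {V : Type*} (G : Trigraph V) (U W : Finset V) : Prop :=
  ∀ u ∈ U, ∀ w ∈ W, ¬ G.black.Adj u w ∧ ¬ G.red.Adj u w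

theorem FullyConnected.symm {V : Type*} {G : Trigraph V} {U W : Finset V}
    (h : G.FullyConnected U W) : G.FullyConnected W U :=
  fun w hw u hu => (h u hu w hw).symm

theorem Disconnected.symm {V : Type*} {G : Trigraph V} {U W : Finset V}
    (h : G.Disconnected U W) : G.Disconnected W U :=
  fun w hw u hu => ⟨fun e => (h u hu w hw).1 e.symm, fun e => (h u hu w hw).2 e.symm⟩

/-- The quotient trigraph `G / P`. Its vertices are the parts of `P`; two distinct parts are joined
by a black edge if they are fully connected, are not adjacent if they are disconnected, and are
joined by a red edge otherwise. -/
def quotient {V : Type*} [Fintype V] [DecidableEq V] (G : Trigraph V)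
    (P : Finpartition (Finset.univ : Finset V)) : Trigraph {U : Finset V // U ∈ P.parts} where
  black :=
    { Adj := fun U W => U ≠ W ∧ G.FullyConnected U W
      symm := ⟨fun _ _ h => ⟨h.1.symm, h.2.symm⟩⟩
      loopless := ⟨fun _ h => h.1 rfl⟩ }
  red :=
    { Adj := fun U W => U ≠ W ∧ ¬ G.FullyConnected U W ∧ ¬ G.Disconnected U W
      symm := ⟨fun _ _ h => ⟨h.1.symm, fun e => h.2.1 e.symm, fun e => h.2.2 e.symm⟩⟩
      loopless := ⟨fun _ h => h.1 rfl⟩ }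
  disjoint := by
    rw [SimpleGraph.disjoint_left]
    exact fun _ _ h h' => h'.2.1 h.2

end Trigraph

/-! ### Partition sequences and twin-width -/

/-- `Q` is obtained from `P` by one merge: two distinct parts `A`, `B` of `P` are replaced by
`A ∪ B`. -/
def IsMerge {V : Type*} [Fintype V] [DecidableEq V]
    (P Q : Finpartition (Finset.univ : Finset V)) : Prop :=
  ∃ A ∈ P.parts, ∃ B ∈ P.parts, A ≠ B ∧ Q.parts = insert (A ∪ B) ((P.parts.erase A).erase B)

/-- `P N, P (N - 1), …, P 1` is a partition sequence, where `N` is the number of vertices: it starts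
with the discrete partition `⊥`, and each further partition arises from the preceding one by one
merge. The values of `P` at indices outside `{1, …, N}` play no role (if `N ≥ 1`). -/
def IsPartitionSequence {V : Type*} [Fintype V] [DecidableEq V]
    (P : ℕ → Finpartition (Finset.univ : Finset V)) : Prop :=
  P (Fintype.card V) = ⊥ ∧
    ∀ i, 1 ≤ i → i < Fintype.card V → IsMerge (P (i + 1)) (P i)

namespace Trigraph

/-- The width of the contraction sequence `G / P N, …, G / P 1`, where `N` is the number of
vertices: the largest red degree that occurs in it. -/
noncomputable def width {V : Type*} [Fintype V] [DecidableEq V] (G : Trigraph V)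
    (P : ℕ → Finpartition (Finset.univ : Finset V)) : ℕ :=
  (Finset.Icc 1 (Fintype.card V)).sup fun i => (G.quotient (P i)).maxRedDegree

/-- The twin-width of a trigraph: the minimal width of a contraction sequence. -/
noncomputable def twinWidth {V : Type*} [Fintype V] [DecidableEq V] (G : Trigraph V) : ℕ :=
  sInf {w | ∃ P : ℕ → Finpartition (Finset.univ : Finset V),
    IsPartitionSequence P ∧ G.width P = w}

end Trigraph

namespace SimpleGraph

/-- The twin-width of a graph. -/
noncomputable def twinWidth {V : Type*} [Fintype V] [DecidableEq V] (G : SimpleGraph V) : ℕ :=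
  G.toTrigraph.twinWidth

/-- The lower bound `lb₁`: the minimal value of the maximum red degree after exactly one merge in
the discrete partition, and `0` if there are fewer than two vertices. -/
noncomputable def lb1 {V : Type*} [Fintype V] [DecidableEq V] (G : SimpleGraph V) : ℕ :=
  if Fintype.card V < 2 then 0
  else sInf {d | ∃ P : Finpartition (Finset.univ : Finset V),
    IsMerge ⊥ P ∧ (G.toTrigraph.quotient P).maxRedDegree = d}

/-- A graph is `lb₁`-collapsible if its twin-width equals `lb₁`. -/
def IsLb1Collapsible {V : Type*} [Fintype V] [DecidableEq V] (G : SimpleGraph V) : Prop :=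
  G.twinWidth = G.lb1

end SimpleGraph

/-! ### Latin squares -/

/-- A Latin square whose rows, columns and symbols are indexed by `α`: each row and each column
contains each symbol exactly once. -/
structure LatinSquare (α : Type*) where
  /-- the symbol in a given row and column -/
  entry : α → α → α
  row_bijective : ∀ r, Function.Bijective fun c => entry r c
  col_bijective : ∀ c, Function.Bijective fun r => entry r c

namespace LatinSquare

/-- The Latin square graph: the vertices are the cells, and two distinct cells are adjacent if they
share their row, their column or their symbol. -/
def graph {α : Type*} (M : LatinSquare α) : SimpleGraph (α × α) where
  Adj v w := v ≠ w ∧ (v.1 = w.1 ∨ v.2 = w.2 ∨ M.entry v.1 v.2 = M.entry w.1 w.2)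
  symm := ⟨fun _ _ h => ⟨h.1.symm, h.2.imp Eq.symm (Or.imp Eq.symm Eq.symm)⟩⟩
  loopless := ⟨fun _ h => h.1 rfl⟩

/-- The Latin square given by the operation table of a group in additive notation. -/
def ofAddGroup (A : Type*) [AddGroup A] : LatinSquare A where
  entry g h := g + h
  row_bijective g := AddGroup.addLeft_bijective g
  col_bijective h := AddGroup.addRight_bijective h

end LatinSquare

open Finset

/-! ### Partitions as fibres of functions -/

/-! Lower bound: merging cells `u`, `v` makes red every other vertex adjacent to exactly one of
them. If `u` and `v` share a line (row, column or symbol), each has two further lines with at least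
`n - 2` private neighbours, in total `4n - 8`; otherwise each has three lines with at least `n - 3`,
in total `6n - 18`. The second count is smaller for `n = 4`, the first is at most the second for `n
≥ 5` (`le_lb1_cyclicLatinGraph`). Every partition sequence starts with such a merge, so `lb1 ≤
twinWidth`.

Upper bound for `n ≥ 5`: pair the columns inside each row (`chain_pair_columns`), then pair the rows
(`chain_pair_rows`), then repeatedly double the width of the column groups (`chain_double_columns`)
until only row pairs remain. In each stage the merges may be done in any order: by `chain_of_ker` it
suffices to bound the red degree in every partition between the fibres of two labellings. Distinct
parts carry disjoint sets of labels of the finer labelling, so a small set of labels meeting all red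
neighbours gives the bound. Adjacency confines these labels to a few lines, and in `ZMod n` the
symbol lines meeting a block of consecutive rows and columns hit another column group in consecutive
rows.

Orders at most 4 are settled by explicit merge lists. -/

/-- The partition of a finite type into the nonempty fibres of a function. -/
def kerPartition {V α : Type*} [Fintype V] [DecidableEq V] [DecidableEq α] (f : V → α) :
    Finpartition (univ : Finset V) :=
  Finpartition.ofExistsUnique (univ.image fun x => univ.filter fun y => f y = f x)
    (fun _ _ => subset_univ _)
    (fun a _ => by
      refine ⟨univ.filter fun y => f y = f a, ⟨mem_image_of_mem _ (mem_univ a), by simp⟩, ?_⟩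
      rintro t ⟨ht, hat⟩
      obtain ⟨x, -, rfl⟩ := mem_image.1 ht
      have hx : f a = f x := by simpa using hat
      simp only [hx])
    (fun h => by
      obtain ⟨x, -, hx⟩ := mem_image.1 h
      have : x ∈ (∅ : Finset V) := hx ▸ (by simp)
      simp at this)

section Partition

variable {V α β : Type*} [Fintype V] [DecidableEq V] [DecidableEq α] [DecidableEq β]

theorem mem_parts_kerPartition {f : V → α} {U : Finset V} :
    U ∈ (kerPartition f).parts ↔ ∃ x, (univ.filter fun y => f y = f x) = U := by
  simp [kerPartition, Finpartition.ofExistsUnique]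

/-- Every partition is a fibre partition, so facts about labellings apply to all partitions. -/
theorem kerPartition_part (P : Finpartition (univ : Finset V)) : kerPartition P.part = P := by
  ext U
  rw [mem_parts_kerPartition]
  have key : ∀ x, (univ.filter fun y => P.part y = P.part x) = P.part x := by
    intro x
    ext y
    rw [P.mem_part_iff_part_eq_part (mem_univ _) (mem_univ _)]
    simp
  constructor
  · rintro ⟨x, rfl⟩
    rw [key]
    simp
  · intro hU
    obtain ⟨x, hx⟩ := P.nonempty_of_mem_parts hU
    exact ⟨x, by rw [key, P.part_eq_of_mem hU hx]⟩

theorem kerPartition_le_iff {f : V → α} {P : Finpartition (univ : Finset V)} :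
    kerPartition f ≤ P ↔ ∀ x y, f x = f y → ∀ U ∈ P.parts, x ∈ U → y ∈ U := by
  constructor
  · intro h x y hxy U hU hx
    obtain ⟨W, hW, hle⟩ := h (mem_parts_kerPartition.2 ⟨x, rfl⟩)
    have hxW : x ∈ W := hle (by simp)
    rw [P.eq_of_mem_parts hU hW hx hxW]
    exact hle (by simp [hxy])
  · intro h W hW
    obtain ⟨x, rfl⟩ := mem_parts_kerPartition.1 hW
    obtain ⟨U, hU, hx⟩ := P.exists_mem (mem_univ x)
    refine ⟨U, hU, fun y hy => h x y ?_ U hU hx⟩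
    simpa using (mem_filter.1 hy).2.symm

theorem le_kerPartition_iff {f : V → α} {P : Finpartition (univ : Finset V)} :
    P ≤ kerPartition f ↔ ∀ U ∈ P.parts, ∀ x ∈ U, ∀ y ∈ U, f x = f y := by
  constructor
  · intro h U hU x hx y hy
    obtain ⟨W, hW, hle⟩ := h hU
    obtain ⟨z, rfl⟩ := mem_parts_kerPartition.1 hW
    have h1 : f x = f z := by simpa using hle hx
    have h2 : f y = f z := by simpa using hle hy
    rw [h1, h2]
  · intro h U hU
    obtain ⟨x, hx⟩ := P.nonempty_of_mem_parts hU
    refine ⟨_, mem_parts_kerPartition.2 ⟨x, rfl⟩, fun y hy => ?_⟩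
    simpa using h U hU y hy x hx

theorem kerPartition_eq_bot {f : V → α} (hf : Function.Injective f) : kerPartition f = ⊥ := by
  refine le_bot_iff.1 fun W hW => ?_
  obtain ⟨x, rfl⟩ := mem_parts_kerPartition.1 hW
  refine ⟨{x}, Finpartition.mem_bot_iff.2 ⟨x, mem_univ x, rfl⟩, fun y hy => ?_⟩
  simpa [hf.eq_iff] using hy

theorem card_parts_kerPartition_le_one {f : V → α} (hf : ∀ x y, f x = f y) :
    (kerPartition f).parts.card ≤ 1 := by
  refine card_le_one.2 fun U hU W hW => ?_
  obtain ⟨x, rfl⟩ := mem_parts_kerPartition.1 hU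
  obtain ⟨y, rfl⟩ := mem_parts_kerPartition.1 hW
  ext z
  simp [hf z x, hf x y]

/-- Giving the fibre of `b` the label of `a` unites these two fibres and leaves the others alone. -/
theorem isMerge_kerPartition {f : V → α} {a b : V} (hab : f a ≠ f b) :
    IsMerge (kerPartition f) (kerPartition fun x => if f x = f b then f a else f x) := by
  refine ⟨_, mem_parts_kerPartition.2 ⟨a, rfl⟩, _, mem_parts_kerPartition.2 ⟨b, rfl⟩, ?_, ?_⟩
  · intro h
    have : a ∈ univ.filter fun y => f y = f b := h ▸ (by simp)
    exact hab (by simpa using this)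
  ext U
  simp only [mem_insert, mem_erase, mem_parts_kerPartition]
  have fibre_ne : ∀ x y, f x ≠ f y →
      (univ.filter fun z => f z = f x) ≠ (univ.filter fun z => f z = f y) := by
    intro x y hxy h
    have : x ∈ univ.filter fun z => f z = f y := h ▸ (by simp)
    exact hxy (by simpa using this)
  have union_eq : (univ.filter fun z => (if f z = f b then f a else f z) = f a) =
      (univ.filter fun y => f y = f a) ∪ (univ.filter fun y => f y = f b) := by
    ext z
    by_cases hz : f z = f b <;> simp [hz]
  have fibre_eq : ∀ x, f x ≠ f a → f x ≠ f b →
      (univ.filter fun z => (if f z = f b then f a else f z) = f x) =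
        univ.filter fun z => f z = f x := by
    intro x hxa hxb
    ext z
    by_cases hz : f z = f b
    · simp [hz, hxa.symm, hxb.symm]
    · simp [hz]
  constructor
  · rintro ⟨x, rfl⟩
    by_cases hxb : f x = f b
    · left
      simp only [hxb, if_true]
      exact union_eq
    by_cases hxa : f x = f a
    · left
      simp only [hxa, hab, if_false]
      exact union_eq
    · right
      simp only [hxb, if_false]
      rw [fibre_eq x hxa hxb]
      exact ⟨fibre_ne _ _ hxb, fibre_ne _ _ hxa, x, rfl⟩
  · rintro (rfl | ⟨h1, h2, x, rfl⟩)
    · refine ⟨a, ?_⟩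
      simp only [hab, if_false]
      exact union_eq
    · have hxb : f x ≠ f b := fun h => h1 (by simp only [h])
      have hxa : f x ≠ f a := fun h => h2 (by simp only [h])
      refine ⟨x, ?_⟩
      simp only [hxb, if_false]
      exact fibre_eq x hxa hxb

theorem IsMerge.card_parts {P Q : Finpartition (univ : Finset V)} (h : IsMerge P Q) :
    P.parts.card = Q.parts.card + 1 := by
  obtain ⟨A, hA, B, hB, hAB, hQ⟩ := h
  have hnot : A ∪ B ∉ (P.parts.erase A).erase B := by
    intro h
    have hmem := mem_of_mem_erase (mem_of_mem_erase h)
    obtain ⟨x, hx⟩ := P.nonempty_of_mem_parts hA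
    have := P.eq_of_mem_parts hA hmem hx (mem_union_left _ hx)
    exact (mem_erase.1 (mem_of_mem_erase h)).1 this.symm
  rw [hQ, card_insert_of_notMem hnot, card_erase_of_mem (mem_erase.2 ⟨hAB.symm, hB⟩),
    card_erase_of_mem hA]
  have : 1 < P.parts.card := one_lt_card.2 ⟨A, hA, B, hB, hAB⟩
  omega

end Partition

/-! ### Red degrees in quotients of graphs -/

namespace SimpleGraph

variable {V : Type*}

/-- Some pair between `U` and `W` is an edge and some pair is not. -/
def IsMixed (G : SimpleGraph V) (U W : Finset V) : Prop :=
  (∃ u ∈ U, ∃ w ∈ W, G.Adj u w) ∧ ∃ u ∈ U, ∃ w ∈ W, ¬ G.Adj u w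

theorem toTrigraph_mixed_iff (G : SimpleGraph V) (U W : Finset V) :
    (¬ G.toTrigraph.FullyConnected U W ∧ ¬ G.toTrigraph.Disconnected U W) ↔ G.IsMixed U W := by
  unfold Trigraph.FullyConnected Trigraph.Disconnected IsMixed SimpleGraph.toTrigraph
  simp only [SimpleGraph.bot_adj, not_false_eq_true, and_true]
  push Not
  exact and_comm

variable [Fintype V] [DecidableEq V] (G : SimpleGraph V)

open Classical in
/-- The parts that are joined to `U` by a red edge. -/
noncomputable def redParts (P : Finpartition (univ : Finset V)) (U : Finset V) :
    Finset (Finset V) :=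
  P.parts.filter fun W => U ≠ W ∧ G.IsMixed U W

variable {G}

theorem mem_redParts {P : Finpartition (univ : Finset V)} {U W : Finset V} :
    W ∈ G.redParts P U ↔ W ∈ P.parts ∧ U ≠ W ∧ G.IsMixed U W := by
  simp [redParts]

theorem redDegree_quotient (P : Finpartition (univ : Finset V)) (U : {U // U ∈ P.parts}) :
    (G.toTrigraph.quotient P).redDegree U = (G.redParts P U).card := by
  unfold Trigraph.redDegree
  rw [← Set.ncard_coe_finset, ← Set.ncard_image_of_injective _ Subtype.val_injective]
  congr 1
  ext W
  simp only [Set.mem_image, SimpleGraph.mem_neighborSet, Subtype.exists, exists_and_right,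
    exists_eq_right, mem_coe, mem_redParts]
  constructor
  · rintro ⟨hW, hne, h⟩
    exact ⟨hW, fun e => hne (Subtype.ext e), (G.toTrigraph_mixed_iff _ _).1 h⟩
  · rintro ⟨hW, hne, h⟩
    exact ⟨hW, fun e => hne (congrArg Subtype.val e), (G.toTrigraph_mixed_iff _ _).2 h⟩

theorem maxRedDegree_quotient_le_iff {P : Finpartition (univ : Finset V)} {k : ℕ} :
    (G.toTrigraph.quotient P).maxRedDegree ≤ k ↔ ∀ U ∈ P.parts, (G.redParts P U).card ≤ k := by
  unfold Trigraph.maxRedDegree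
  simp [Finset.sup_le_iff, redDegree_quotient]

variable (G) in
/-- One merge into a partition of width at most `k`. -/
def MergeStep (k : ℕ) (P Q : Finpartition (univ : Finset V)) : Prop :=
  IsMerge P Q ∧ (G.toTrigraph.quotient Q).maxRedDegree ≤ k

theorem maxRedDegree_quotient_bot : (G.toTrigraph.quotient ⊥).maxRedDegree = 0 := by
  refine Nat.le_zero.1 (maxRedDegree_quotient_le_iff.2 fun U hU => ?_)
  rw [Nat.le_zero, card_eq_zero, eq_empty_iff_forall_notMem]
  intro W hW
  obtain ⟨hW', -, ⟨u, hu, w, hw, h⟩, ⟨u', hu', w', hw', h'⟩⟩ := mem_redParts.1 hW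
  obtain ⟨x, -, rfl⟩ := Finpartition.mem_bot_iff.1 hU
  obtain ⟨y, -, rfl⟩ := Finpartition.mem_bot_iff.1 hW'
  simp only [mem_singleton] at hu hw hu' hw'
  subst hu hw hu' hw'
  exact h' h

/-- A merge lowers the number of parts by one, so indexing partitions by their number of parts turns
a chain into a sequence with the required indices. -/
theorem exists_partial_sequence {k : ℕ} {Q : Finpartition (univ : Finset V)}
    (h : Relation.ReflTransGen (G.MergeStep k) ⊥ Q) :
    Q.parts.card ≤ Fintype.card V ∧ ∃ f : ℕ → Finpartition (univ : Finset V),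
      f (Fintype.card V) = ⊥ ∧ f Q.parts.card = Q ∧
      (∀ i, Q.parts.card ≤ i → i < Fintype.card V → IsMerge (f (i + 1)) (f i)) ∧
      ∀ i, Q.parts.card ≤ i → i ≤ Fintype.card V →
        (G.toTrigraph.quotient (f i)).maxRedDegree ≤ k := by
  induction h with
  | refl =>
    refine ⟨by simp [Finset.card_univ], fun _ => ⊥, rfl, rfl, ?_, ?_⟩
    · intro i h1 h2
      rw [Finpartition.card_bot, Finset.card_univ] at h1
      omega
    · intro i _ _
      rw [maxRedDegree_quotient_bot]
      exact Nat.zero_le _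
  | @tail P Q _ hPQ ih =>
    obtain ⟨hle, f, h0, hP, hm, hw⟩ := ih
    have hc := hPQ.1.card_parts
    refine ⟨by omega, Function.update f Q.parts.card Q, ?_, by simp, ?_, ?_⟩
    · rw [Function.update_of_ne (by omega), h0]
    · intro i h1 h2
      rw [Function.update_of_ne (by omega : i + 1 ≠ Q.parts.card)]
      rcases h1.eq_or_lt with rfl | h1
      · rw [Function.update_self, ← hc, hP]
        exact hPQ.1
      · rw [Function.update_of_ne (by omega)]
        exact hm i (by omega) h2
    · intro i h1 h2
      rcases h1.eq_or_lt with rfl | h1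
      · rw [Function.update_self]
        exact hPQ.2
      · rw [Function.update_of_ne (by omega)]
        exact hw i (by omega) h2

/-- A chain of merges of width at most `k` down to at most one part bounds the twin-width. -/
theorem twinWidth_le_of_chain [Nonempty V] {k : ℕ} {Q : Finpartition (univ : Finset V)}
    (h : Relation.ReflTransGen (G.MergeStep k) ⊥ Q) (hQ : Q.parts.card ≤ 1) :
    G.twinWidth ≤ k := by
  obtain ⟨-, f, h0, -, hm, hw⟩ := exists_partial_sequence h
  refine (Nat.sInf_le ⟨f, ⟨h0, fun i h1 h2 => hm i (by omega) h2⟩, rfl⟩ :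
    G.twinWidth ≤ G.toTrigraph.width f).trans ?_
  refine Finset.sup_le fun i hi => ?_
  rw [Finset.mem_Icc] at hi
  exact hw i (by omega) hi.2

/-- If all partitions between `F` and `Q` have width at most `k`, then `Q` can be reached
from `F`. -/
theorem chain_of_interval {k : ℕ} {Q : Finpartition (univ : Finset V)} (m : ℕ) :
    ∀ F : Finpartition (univ : Finset V), F.parts.card ≤ m → F ≤ Q →
      (∀ P, F ≤ P → P ≤ Q → (G.toTrigraph.quotient P).maxRedDegree ≤ k) →
      Relation.ReflTransGen (G.MergeStep k) F Q := by
  induction m with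
  | zero =>
    intro F hF hFQ h
    have : Q ≤ F := by
      intro U hU
      obtain ⟨x, -⟩ := Q.nonempty_of_mem_parts hU
      obtain ⟨W, hW, -⟩ := F.exists_mem (mem_univ x)
      have := card_pos.2 ⟨W, hW⟩
      omega
    rw [le_antisymm hFQ this]
  | succ m ih =>
    intro F hF hFQ h
    by_cases hQF : Q ≤ F
    · rw [le_antisymm hFQ hQF]
    -- Some part of `Q` meets two parts of `F`; merging these two stays below `Q`.
    rw [← kerPartition_part F, le_kerPartition_iff] at hQF
    push Not at hQF
    obtain ⟨U, hU, a, ha, b, hb, hab⟩ := hQF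
    have hmerge := isMerge_kerPartition (f := F.part) hab
    set F' := kerPartition fun x => if F.part x = F.part b then F.part a else F.part x with hF'
    rw [kerPartition_part] at hmerge
    have hFF' : F ≤ F' := by
      conv_lhs => rw [← kerPartition_part F]
      rw [hF', le_kerPartition_iff]
      intro U hU x hx y hy
      have : F.part x = F.part y := le_kerPartition_iff.1 le_rfl U hU x hx y hy
      simp only [this]
    have hFmem : ∀ x y, F.part x = F.part y → ∀ U ∈ Q.parts, x ∈ U → y ∈ U := by
      rw [← kerPartition_le_iff, kerPartition_part]
      exact hFQ
    have hF'Q : F' ≤ Q := by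
      rw [hF', kerPartition_le_iff]
      intro x y hxy W hW hx
      by_cases hxb : F.part x = F.part b
      · have hbW := hFmem x b hxb W hW hx
        obtain rfl := Q.eq_of_mem_parts hU hW hb hbW
        by_cases hyb : F.part y = F.part b
        · exact hFmem b y hyb.symm U hU hb
        · simp only [hxb, hyb, if_true, if_false] at hxy
          exact hFmem a y hxy U hU ha
      · by_cases hyb : F.part y = F.part b
        · simp only [hxb, hyb, if_true, if_false] at hxy
          have haW := hFmem x a hxy W hW hx
          obtain rfl := Q.eq_of_mem_parts hU hW ha haW
          exact hFmem b y hyb.symm U hU hb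
        · simp only [hxb, hyb, if_false] at hxy
          exact hFmem x y hxy W hW hx
    refine Relation.ReflTransGen.head ⟨hmerge, h F' hFF' hF'Q⟩ (ih F' ?_ hF'Q ?_)
    · have := hmerge.card_parts
      omega
    · exact fun P h1 h2 => h P (hFF'.trans h1) h2

/-- The number of red edges at a part is at most the size of a set of labels that occur in all
parts at the other ends. -/
theorem card_redParts_le {α : Type*} [DecidableEq α] {f : V → α}
    {P : Finpartition (univ : Finset V)} (hf : kerPartition f ≤ P) {U : Finset V} (S : Finset α)
    (hS : ∀ W ∈ G.redParts P U, ∃ w ∈ W, f w ∈ S) : (G.redParts P U).card ≤ S.card := by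
  rcases isEmpty_or_nonempty V with hV | hV
  · rw [eq_empty_iff_forall_notMem.2 fun W hW => hV.false (hS W hW).choose]
    simp
  -- The chosen labels are distinct for distinct parts, since a whole fibre of `f` lies in one part.
  choose! g hg using hS
  refine card_le_card_of_injOn (fun W => f (g W)) (fun W hW => (hg W hW).2) ?_
  intro W hW W' hW' h
  have h1 := (mem_redParts.1 hW).1
  have h2 := (mem_redParts.1 hW').1
  exact P.eq_of_mem_parts h1 h2 (kerPartition_le_iff.1 hf _ _ h W h1 (hg W hW).1) (hg W' hW').1

/-- A criterion for passing from the fibres of `f` to those of `g` by merges in any order. -/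
theorem chain_of_ker {α β : Type*} [DecidableEq α] [DecidableEq β] {f : V → α} {g : V → β}
    {k : ℕ} (hfg : ∀ x y, f x = f y → g x = g y)
    (h : ∀ P : Finpartition (univ : Finset V),
      (∀ x y, f x = f y → ∀ U ∈ P.parts, x ∈ U → y ∈ U) →
      (∀ U ∈ P.parts, ∀ x ∈ U, ∀ y ∈ U, g x = g y) →
      ∀ U ∈ P.parts, ∃ S : Finset α, S.card ≤ k ∧ ∀ W ∈ P.parts, U ≠ W → G.IsMixed U W →
        ∃ w ∈ W, f w ∈ S) :
    Relation.ReflTransGen (G.MergeStep k) (kerPartition f) (kerPartition g) := by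
  refine chain_of_interval _ _ le_rfl ?_ ?_
  · rw [kerPartition_le_iff]
    intro x y hxy U hU hx
    obtain ⟨z, rfl⟩ := mem_parts_kerPartition.1 hU
    simp only [mem_filter, mem_univ, true_and] at hx ⊢
    rw [← hfg x y hxy, hx]
  · intro P hFP hPQ
    rw [maxRedDegree_quotient_le_iff]
    intro U hU
    obtain ⟨S, hSk, hS⟩ := h P (kerPartition_le_iff.1 hFP) (le_kerPartition_iff.1 hPQ) U hU
    refine (card_redParts_le hFP S fun W hW => ?_).trans hSk
    obtain ⟨h1, h2, h3⟩ := mem_redParts.1 hW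
    exact hS W h1 h2 h3

/-- Once there are at most `k + 1` labels, everything can be merged. -/
theorem chain_of_card_image_le {α β : Type*} [DecidableEq α] [DecidableEq β] {f : V → α}
    {g : V → β} {k : ℕ} (hg : ∀ x y, g x = g y) (hk : (univ.image f).card ≤ k + 1) :
    Relation.ReflTransGen (G.MergeStep k) (kerPartition f) (kerPartition g) := by
  refine chain_of_ker (fun x y _ => hg x y) fun P hP _ U hU => ?_
  obtain ⟨u, hu⟩ := P.nonempty_of_mem_parts hU
  refine ⟨(univ.image f).erase (f u), ?_, fun W hW hUW _ => ?_⟩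
  · rw [card_erase_of_mem (mem_image_of_mem _ (mem_univ u))]
    omega
  · obtain ⟨w, hw⟩ := P.nonempty_of_mem_parts hW
    refine ⟨w, hw, mem_erase.2 ⟨fun h => hUW ?_, mem_image_of_mem _ (mem_univ w)⟩⟩
    exact P.eq_of_mem_parts hU hW (hP w u h W hW hw |> fun h' => (hP u w h.symm U hU hu)) hw

/-! ### The bound `lb₁` -/

theorem lb1_le_of_isPartitionSequence {f : ℕ → Finpartition (univ : Finset V)}
    (hf : IsPartitionSequence f) : G.lb1 ≤ G.toTrigraph.width f := by
  unfold lb1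
  split_ifs with hV
  · exact Nat.zero_le _
  have hm := hf.2 (Fintype.card V - 1) (by omega) (by omega)
  rw [Nat.sub_add_cancel (by omega), hf.1] at hm
  have hmem : (G.toTrigraph.quotient (f (Fintype.card V - 1))).maxRedDegree ∈
      {d | ∃ P : Finpartition (Finset.univ : Finset V),
        IsMerge ⊥ P ∧ (G.toTrigraph.quotient P).maxRedDegree = d} := ⟨_, hm, rfl⟩
  refine (Nat.sInf_le hmem).trans ?_
  exact Finset.le_sup (f := fun i => (G.toTrigraph.quotient (f i)).maxRedDegree)
    (Finset.mem_Icc.2 ⟨by omega, by omega⟩)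

/-- Some partition sequence exists. -/
theorem exists_isPartitionSequence [Nonempty V] :
    ∃ f : ℕ → Finpartition (univ : Finset V), IsPartitionSequence f := by
  -- With width bound `Fintype.card V` the red-degree condition is no restriction; the graph is
  -- irrelevant.
  have h : Relation.ReflTransGen ((⊥ : SimpleGraph V).MergeStep (Fintype.card V))
      (kerPartition (id : V → V)) (kerPartition fun _ => ()) := by
    refine chain_of_card_image_le (fun _ _ => rfl) ?_
    exact (Finset.card_le_univ _).trans (Nat.le_succ _)
  rw [kerPartition_eq_bot Function.injective_id] at h
  have hc := card_parts_kerPartition_le_one (V := V) (f := fun _ => ()) fun _ _ => rfl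
  obtain ⟨-, f, h0, -, hm, -⟩ := exists_partial_sequence h
  exact ⟨f, h0, fun i h1 h2 => hm i (by omega) h2⟩

variable (G) in
theorem lb1_le_twinWidth [Nonempty V] : G.lb1 ≤ G.twinWidth := by
  obtain ⟨f, hf⟩ := exists_isPartitionSequence (V := V)
  unfold SimpleGraph.twinWidth Trigraph.twinWidth
  -- Nonemptiness matters: `sInf` of the empty set would be `0`.
  refine le_csInf ⟨_, f, hf, rfl⟩ ?_
  rintro w ⟨f, hf, rfl⟩
  exact lb1_le_of_isPartitionSequence hf

open Classical in
/-- Merging `u` and `v` first, all vertices adjacent to exactly one of them become red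
neighbours. -/
theorem le_lb1 {d : ℕ} (hV : 2 ≤ Fintype.card V)
    (h : ∀ u v, u ≠ v →
      d ≤ (univ.filter fun w => w ≠ u ∧ w ≠ v ∧ ¬ (G.Adj u w ↔ G.Adj v w)).card) :
    d ≤ G.lb1 := by
  unfold lb1
  rw [if_neg (by omega)]
  have : Nonempty V := Fintype.card_pos_iff.1 (by omega)
  obtain ⟨f, hf⟩ := exists_isPartitionSequence (V := V)
  have hm := hf.2 (Fintype.card V - 1) (by omega) (by omega)
  rw [Nat.sub_add_cancel (by omega), hf.1] at hm
  refine le_csInf ⟨_, _, hm, rfl⟩ ?_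
  rintro _ ⟨P, ⟨A, hA, B, hB, hAB, hP⟩, rfl⟩
  obtain ⟨u, -, rfl⟩ := Finpartition.mem_bot_iff.1 hA
  obtain ⟨v, -, rfl⟩ := Finpartition.mem_bot_iff.1 hB
  have huv : u ≠ v := fun h => hAB (by rw [h])
  refine (h u v huv).trans (le_trans ?_
    (maxRedDegree_quotient_le_iff.1 le_rfl ({u} ∪ {v}) (by rw [hP]; exact mem_insert_self _ _)))
  refine card_le_card_of_injOn (fun w => {w}) (fun w hw => ?_) (fun x _ y _ hxy => by simpa using hxy)
  simp only [coe_filter, mem_univ, true_and, Set.mem_ofPred_eq] at hw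
  obtain ⟨hwu, hwv, hw⟩ := hw
  rw [mem_coe, mem_redParts, hP]
  refine ⟨mem_insert_of_mem (mem_erase.2 ⟨by simpa using hwv, mem_erase.2 ⟨by simpa using hwu,
    Finpartition.mem_bot_iff.2 ⟨w, mem_univ w, rfl⟩⟩⟩), ?_, ?_⟩
  · intro h
    have : u ∈ ({w} : Finset V) := (Finset.ext_iff.1 h u).1 (by simp)
    exact hwu (mem_singleton.1 this).symm
  · by_cases h1 : G.Adj u w
    · have h2 : ¬ G.Adj v w := fun h2 => hw ⟨fun _ => h2, fun _ => h1⟩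
      exact ⟨⟨u, by simp, w, by simp, h1⟩, ⟨v, by simp, w, by simp, h2⟩⟩
    · have h2 : G.Adj v w := by
        by_contra h2
        exact hw ⟨fun h => absurd h h1, fun h => absurd h h2⟩
      exact ⟨⟨v, by simp, w, by simp, h2⟩, ⟨u, by simp, w, by simp, h1⟩⟩

end SimpleGraph

/-! ### The lower bound for Latin square graphs of cyclic groups -/

/-- The Latin square graph of the cyclic group of order `n`. -/
abbrev cyclicLatinGraph (n : ℕ) : SimpleGraph (ZMod n × ZMod n) :=
  (LatinSquare.ofAddGroup (ZMod n)).graph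

theorem cyclicLatinGraph_adj {n : ℕ} {v w : ZMod n × ZMod n} :
    (cyclicLatinGraph n).Adj v w ↔
      v ≠ w ∧ (v.1 = w.1 ∨ v.2 = w.2 ∨ v.1 + v.2 = w.1 + w.2) := Iff.rfl

theorem le_card_image_sdiff {n : ℕ} [NeZero n] {β : Type*} [DecidableEq β] {f : ZMod n → β}
    (hf : Function.Injective f) (s : Finset (ZMod n)) :
    n - s.card ≤ ((univ \ s).image f).card := by
  rw [card_image_of_injective _ hf]
  have := le_card_sdiff s (univ : Finset (ZMod n))
  rwa [card_univ, ZMod.card] at this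

theorem le_card_of_two_lines {n : ℕ} [NeZero n] {β : Type*} [DecidableEq β] {T : Finset β}
    {f g : ZMod n → β} (hf : Function.Injective f) (hg : Function.Injective g)
    (s t : Finset (ZMod n)) (hs : s.card ≤ 2) (ht : t.card ≤ 2)
    (hfT : ∀ x, x ∉ s → f x ∈ T) (hgT : ∀ x, x ∉ t → g x ∈ T)
    (hfg : ∀ x y, x ∉ s → y ∉ t → f x ≠ g y) : 2 * n - 4 ≤ T.card := by
  have h1 := le_card_image_sdiff hf s
  have h2 := le_card_image_sdiff hg t
  have hd : Disjoint ((univ \ s).image f) ((univ \ t).image g) := by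
    rw [disjoint_left]
    simp only [mem_image, mem_sdiff, mem_univ, true_and]
    rintro _ ⟨x, hx, rfl⟩ ⟨y, hy, h⟩
    exact hfg x y hx hy h.symm
  have hsub : (univ \ s).image f ∪ (univ \ t).image g ⊆ T := by
    refine union_subset ?_ ?_ <;> intro z hz <;>
      simp only [mem_image, mem_sdiff, mem_univ, true_and] at hz <;> obtain ⟨x, hx, rfl⟩ := hz
    exacts [hfT x hx, hgT x hx]
  have := card_le_card hsub
  rw [card_union_of_disjoint hd] at this
  omega

theorem le_card_of_three_lines {n : ℕ} [NeZero n] {β : Type*} [DecidableEq β] {T : Finset β}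
    {f g h : ZMod n → β} (hf : Function.Injective f) (hg : Function.Injective g)
    (hh : Function.Injective h) (s t r : Finset (ZMod n)) (hs : s.card ≤ 3) (ht : t.card ≤ 3)
    (hr : r.card ≤ 3) (hfT : ∀ x, x ∉ s → f x ∈ T) (hgT : ∀ x, x ∉ t → g x ∈ T)
    (hhT : ∀ x, x ∉ r → h x ∈ T) (hfg : ∀ x y, x ∉ s → y ∉ t → f x ≠ g y)
    (hfh : ∀ x y, x ∉ s → y ∉ r → f x ≠ h y) (hgh : ∀ x y, x ∉ t → y ∉ r → g x ≠ h y) :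
    3 * n - 9 ≤ T.card := by
  have h1 := le_card_image_sdiff hf s
  have h2 := le_card_image_sdiff hg t
  have h3 := le_card_image_sdiff hh r
  have hd : Disjoint ((univ \ s).image f) ((univ \ t).image g) := by
    rw [disjoint_left]
    simp only [mem_image, mem_sdiff, mem_univ, true_and]
    rintro _ ⟨x, hx, rfl⟩ ⟨y, hy, h⟩
    exact hfg x y hx hy h.symm
  have hd' : Disjoint ((univ \ s).image f ∪ (univ \ t).image g) ((univ \ r).image h) := by
    rw [disjoint_left]
    simp only [mem_union, mem_image, mem_sdiff, mem_univ, true_and]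
    rintro _ (⟨x, hx, rfl⟩ | ⟨x, hx, rfl⟩) ⟨y, hy, h⟩
    exacts [hfh x y hx hy h.symm, hgh x y hx hy h.symm]
  have hsub : (univ \ s).image f ∪ (univ \ t).image g ∪ (univ \ r).image h ⊆ T := by
    refine union_subset (union_subset ?_ ?_) ?_ <;> intro z hz <;>
      simp only [mem_image, mem_sdiff, mem_univ, true_and] at hz <;> obtain ⟨x, hx, rfl⟩ := hz
    exacts [hfT x hx, hgT x hx, hhT x hx]
  have := card_le_card hsub
  rw [card_union_of_disjoint hd', card_union_of_disjoint hd] at this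
  omega

open Classical in
/-- The number of vertices that are adjacent to `u` but not to `v`. -/
theorem le_card_private_neighbors {n : ℕ} [NeZero n] {u v : ZMod n × ZMod n} (huv : u ≠ v) :
    min (2 * n - 4) (3 * n - 9) ≤ (univ.filter fun w => w ≠ v ∧ (cyclicLatinGraph n).Adj u w ∧
      ¬ (cyclicLatinGraph n).Adj v w).card := by
  obtain ⟨r, c⟩ := u
  obtain ⟨r', c'⟩ := v
  have hrow : Function.Injective fun t : ZMod n => (r, t) := fun x y h => by simpa using h
  have hcol : Function.Injective fun t : ZMod n => (t, c) := fun x y h => by simpa using h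
  have hsym : Function.Injective fun t : ZMod n => (t, r + c - t) := fun x y h => by
    simp only [Prod.mk.injEq] at h
    exact h.1
  by_cases h1 : r = r'
  -- With a common line, only the two other lines of `u` count; from each, `u` and its other
  -- intersection with a line of `v` are removed.
  · refine (min_le_left _ _).trans (le_card_of_two_lines hcol hsym {r, r + c' - c} {r, r + c - c'}
      card_le_two card_le_two ?_ ?_ ?_) <;>
      simp only [mem_filter, mem_univ, true_and, cyclicLatinGraph_adj, mem_insert, mem_singleton,
        Prod.mk.injEq, ne_eq] at * <;> grind
  by_cases h2 : c = c'
  · refine (min_le_left _ _).trans (le_card_of_two_lines hrow hsym {c, r' + c - r} {r, r'}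
      card_le_two card_le_two ?_ ?_ ?_) <;>
      simp only [mem_filter, mem_univ, true_and, cyclicLatinGraph_adj, mem_insert, mem_singleton,
        Prod.mk.injEq, ne_eq] at * <;> grind
  by_cases h3 : r + c = r' + c'
  · refine (min_le_left _ _).trans (le_card_of_two_lines hrow hcol {c, c'} {r, r'}
      card_le_two card_le_two ?_ ?_ ?_) <;>
      simp only [mem_filter, mem_univ, true_and, cyclicLatinGraph_adj, mem_insert, mem_singleton,
        Prod.mk.injEq, ne_eq] at * <;> grind
  -- Without a common line, each line of `u` loses `u` and its intersections with the two lines of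
  -- `v` of the other kinds.
  refine (min_le_right _ _).trans (le_card_of_three_lines hrow hcol hsym {c, c', r' + c' - r}
    {r, r', r' + c' - c} {r, r', r + c - c'} card_le_three card_le_three card_le_three
    ?_ ?_ ?_ ?_ ?_ ?_) <;>
      simp only [mem_filter, mem_univ, true_and, cyclicLatinGraph_adj, mem_insert, mem_singleton,
        Prod.mk.injEq, ne_eq] at * <;> grind

/-- The private neighbours of `u` and those of `v` are disjoint, hence the factor 2. -/
theorem le_lb1_cyclicLatinGraph {n : ℕ} [NeZero n] (hn : 2 ≤ n) :
    2 * min (2 * n - 4) (3 * n - 9) ≤ (cyclicLatinGraph n).lb1 := by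
  refine SimpleGraph.le_lb1 ?_ fun u v huv => ?_
  · rw [Fintype.card_prod, ZMod.card]
    nlinarith
  classical
  have h1 := le_card_private_neighbors huv
  have h2 := le_card_private_neighbors huv.symm
  rw [two_mul]
  refine (add_le_add h1 h2).trans ?_
  rw [← card_union_of_disjoint]
  · refine card_le_card fun w hw => ?_
    simp only [mem_union, mem_filter, mem_univ, true_and] at hw ⊢
    rcases hw with ⟨h, h', h''⟩ | ⟨h, h', h''⟩
    · exact ⟨h'.ne.symm, h, fun e => h'' (e.1 h')⟩
    · exact ⟨h, h'.ne.symm, fun e => h'' (e.2 h')⟩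
  · rw [disjoint_left]
    simp only [mem_filter, mem_univ, true_and]
    exact fun w h h' => h.2.2 h'.2.1

/-! ### Small orders -/

namespace SimpleGraph

variable {V : Type*} [Fintype V] [DecidableEq V]

/-- Merge successively the fibres of the given pairs of vertices. -/
def mergeFibres (f : V → V) : List (V × V) → V → V
  | [] => f
  | p :: l => mergeFibres (fun x => if f x = f p.2 then f p.1 else f x) l

/-- The labels of the fibres of `f` that are joined to the fibre of `u` by a red edge. -/
def redLabels (G : SimpleGraph V) [DecidableRel G.Adj] (f : V → V) (u : V) : Finset V :=
  (univ.image f).filter fun a => a ≠ f u ∧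
    (∃ x, f x = f u ∧ ∃ y, f y = a ∧ G.Adj x y) ∧ ∃ x, f x = f u ∧ ∃ y, f y = a ∧ ¬ G.Adj x y

/-- All merges prescribed by the list are merges of distinct parts, with red degree at most `k`. -/
def MergesWithin (G : SimpleGraph V) [DecidableRel G.Adj] (k : ℕ) (f : V → V) :
    List (V × V) → Prop
  | [] => True
  | p :: l => f p.1 ≠ f p.2 ∧
      (∀ u, (G.redLabels (fun x => if f x = f p.2 then f p.1 else f x) u).card ≤ k) ∧
      MergesWithin G k (fun x => if f x = f p.2 then f p.1 else f x) l

instance (G : SimpleGraph V) [DecidableRel G.Adj] (k : ℕ) :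
    ∀ (l : List (V × V)) (f : V → V), Decidable (G.MergesWithin k f l)
  | [], _ => isTrue trivial
  | p :: l, f =>
    have := instDecidableMergesWithin G k l (fun x => if f x = f p.2 then f p.1 else f x)
    inferInstanceAs (Decidable (_ ∧ _ ∧ _))

variable {G : SimpleGraph V} [DecidableRel G.Adj]

/-- Red degrees are bounded by decidable label counts, so explicit merge lists can be checked by
evaluation. -/
theorem maxRedDegree_kerPartition_le {k : ℕ} {f : V → V}
    (h : ∀ u, (G.redLabels f u).card ≤ k) :
    (G.toTrigraph.quotient (kerPartition f)).maxRedDegree ≤ k := by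
  rw [maxRedDegree_quotient_le_iff]
  intro U hU
  obtain ⟨u, rfl⟩ := mem_parts_kerPartition.1 hU
  refine (card_redParts_le (f := f) le_rfl (G.redLabels f u) fun W hW => ?_).trans (h u)
  obtain ⟨hW, hne, ⟨x, hx, y, hy, hxy⟩, ⟨x', hx', y', hy', hxy'⟩⟩ := mem_redParts.1 hW
  obtain ⟨w, rfl⟩ := mem_parts_kerPartition.1 hW
  simp only [mem_filter, mem_univ, true_and] at hx hy hx' hy'
  refine ⟨w, by simp, ?_⟩
  simp only [redLabels, mem_filter, mem_image, mem_univ, true_and]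
  exact ⟨⟨w, rfl⟩, fun e => hne (by rw [e]), ⟨x, hx, y, hy, hxy⟩, ⟨x', hx', y', hy', hxy'⟩⟩

theorem chain_of_mergesWithin {k : ℕ} (l : List (V × V)) :
    ∀ f : V → V, G.MergesWithin k f l →
      Relation.ReflTransGen (G.MergeStep k) (kerPartition f) (kerPartition (mergeFibres f l)) := by
  induction l with
  | nil => exact fun f _ => Relation.ReflTransGen.refl
  | cons p l ih =>
    intro f h
    exact Relation.ReflTransGen.head
      ⟨isMerge_kerPartition h.1, maxRedDegree_kerPartition_le h.2.1⟩ (ih _ h.2.2)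

/-- A list of merges within a bound, down to few enough parts, bounds the twin-width. -/
theorem twinWidth_le_of_mergesWithin [Nonempty V] {k : ℕ} (l : List (V × V))
    (hl : G.MergesWithin k id l) (hc : (univ.image (mergeFibres id l)).card ≤ k + 1) :
    G.twinWidth ≤ k := by
  have h := chain_of_mergesWithin l id hl
  rw [kerPartition_eq_bot Function.injective_id] at h
  exact twinWidth_le_of_chain
    (h.trans (chain_of_card_image_le (g := fun _ => ()) (fun _ _ => rfl) hc))
    (card_parts_kerPartition_le_one fun _ _ => rfl)

end SimpleGraph

instance (n : ℕ) : DecidableRel (cyclicLatinGraph n).Adj := fun v w =>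
  inferInstanceAs (Decidable (v ≠ w ∧ (v.1 = w.1 ∨ v.2 = w.2 ∨ v.1 + v.2 = w.1 + w.2)))

theorem twinWidth_cyclicLatinGraph_one_le : (cyclicLatinGraph 1).twinWidth ≤ 0 :=
  SimpleGraph.twinWidth_le_of_mergesWithin [] (by decide) (by decide)

theorem twinWidth_cyclicLatinGraph_two_le : (cyclicLatinGraph 2).twinWidth ≤ 0 :=
  SimpleGraph.twinWidth_le_of_mergesWithin
    [((0, 0), (0, 1)), ((0, 0), (1, 0)), ((0, 0), (1, 1))] (by decide +kernel) (by decide +kernel)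

/-- The graph is complete tripartite with classes given by constant `c - r`; the list first merges
each class, which consists of twins. -/
theorem twinWidth_cyclicLatinGraph_three_le : (cyclicLatinGraph 3).twinWidth ≤ 0 :=
  SimpleGraph.twinWidth_le_of_mergesWithin
    [((0, 0), (1, 1)), ((0, 0), (2, 2)), ((0, 1), (1, 2)), ((0, 1), (2, 0)), ((0, 2), (1, 0)),
      ((0, 2), (2, 1)), ((0, 0), (0, 1)), ((0, 0), (0, 2))]
    (by decide +kernel) (by decide +kernel)

/-- The first merge takes two cells with no common line, since a common line would cost 8. Nine
merges leave 7 parts, after which red degree 6 cannot be exceeded. -/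
theorem twinWidth_cyclicLatinGraph_four_le : (cyclicLatinGraph 4).twinWidth ≤ 6 :=
  SimpleGraph.twinWidth_le_of_mergesWithin
    [((2, 3), (3, 0)), ((0, 3), (2, 2)), ((1, 2), (2, 0)), ((0, 2), (1, 3)), ((3, 2), (3, 3)),
      ((3, 1), (2, 2)), ((1, 0), (1, 3)), ((0, 1), (1, 1)), ((2, 1), (3, 0))]
    (by decide +kernel) (by decide +kernel)

/-! ### Partition sequences for orders at least five -/

theorem zmod_one_ne_zero {n : ℕ} (hn : 5 ≤ n) : (1 : ZMod n) ≠ 0 := by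
  have : Fact (1 < n) := ⟨by omega⟩
  exact one_ne_zero

theorem zmod_two_ne_zero {n : ℕ} (hn : 5 ≤ n) : (2 : ZMod n) ≠ 0 := by
  intro h
  have : ((2 : ℕ) : ZMod n) = 0 := by exact_mod_cast h
  rw [ZMod.natCast_eq_zero_iff] at this
  exact absurd (Nat.le_of_dvd two_pos this) (by omega)

section Stages

variable {n : ℕ} [NeZero n]

theorem exists_offset {b : ℕ} (hb : 0 < b) (x : ZMod n) :
    ∃ t < b, x = ((b * (x.val / b) + t : ℕ) : ZMod n) :=
  ⟨x.val % b, Nat.mod_lt _ hb, by rw [Nat.div_add_mod, ZMod.natCast_zmod_val]⟩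

theorem eq_or_eq_add_one_of_val_div_two {x : ZMod n} {j : ℕ} (h : x.val / 2 = j) :
    x = 2 * (j : ZMod n) ∨ x = 2 * (j : ZMod n) + 1 := by
  obtain ⟨t, ht, hx⟩ := exists_offset two_pos x
  rw [h] at hx
  interval_cases t
  · left
    rw [hx]
    push_cast
    ring
  · right
    rw [hx]
    push_cast
    ring

theorem val_div_lt (x : ZMod n) (b : ℕ) : x.val / b < (n - 1) / b + 1 :=
  Nat.lt_succ_of_le (Nat.div_le_div_right (Nat.le_sub_one_of_lt x.val_lt))

theorem card_image_sdiff_pair {β : Type*} [DecidableEq β] (f : ZMod n → β) {a b : ZMod n}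
    (hab : a ≠ b) : ((univ \ {a, b}).image f).card ≤ n - 2 := by
  refine card_image_le.trans ?_
  rw [card_sdiff_of_subset (subset_univ _), card_univ, ZMod.card, card_pair hab]

theorem card_image_erase {β : Type*} [DecidableEq β] (f : ZMod n → β) (a : ZMod n) :
    ((univ.erase a).image f).card ≤ n - 1 := by
  refine card_image_le.trans ?_
  rw [card_erase_of_mem (mem_univ a), card_univ, ZMod.card]

/-- The cells that make a part a red neighbour of the pair of `(r, e)` and `(r, e + 1)` while
columns are merged in pairs. -/
def pairNeighbors (r e : ZMod n) : Finset (ZMod n × ZMod n) :=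
  ((univ \ {r, r + 1}).image fun t => (t, e)) ∪
    ((univ \ {r, r - 1}).image fun t => (t, e + 1)) ∪
    ((univ \ {r, r - 1}).image fun t => (t, r + e - t)) ∪
    ((univ \ {r, r + 1}).image fun t => (t, r + e + 1 - t))

theorem card_pairNeighbors_le (hn : 2 ≤ n) {r e : ZMod n} (hr1 : r ≠ r + 1) (hr2 : r ≠ r - 1) :
    (pairNeighbors r e).card ≤ 4 * n - 8 := by
  refine (card_union_le _ _).trans ?_
  have h1 := card_union_le (((univ \ {r, r + 1}).image fun t => (t, e)) ∪
    ((univ \ {r, r - 1}).image fun t => (t, e + 1)))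
    ((univ \ {r, r - 1}).image fun t => (t, r + e - t))
  have h2 := card_union_le ((univ \ {r, r + 1}).image fun t => (t, e))
    ((univ \ {r, r - 1}).image fun t => (t, e + 1))
  have h3 := card_image_sdiff_pair (fun t : ZMod n => (t, e)) hr1
  have h4 := card_image_sdiff_pair (fun t : ZMod n => (t, e + 1)) hr2
  have h5 := card_image_sdiff_pair (fun t : ZMod n => (t, r + e - t)) hr2
  have h6 := card_image_sdiff_pair (fun t : ZMod n => (t, r + e + 1 - t)) hr1
  omega

theorem mem_pairNeighbors_iff {r e ρ d : ZMod n} : (ρ, d) ∈ pairNeighbors r e ↔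
    ρ ≠ r ∧ ((ρ ≠ r + 1 ∧ d = e) ∨ (ρ ≠ r - 1 ∧ d = e + 1) ∨ (ρ ≠ r - 1 ∧ d = r + e - ρ) ∨
      (ρ ≠ r + 1 ∧ d = r + e + 1 - ρ)) := by
  simp only [pairNeighbors, mem_union, mem_image, mem_sdiff, mem_univ, true_and, mem_insert,
    mem_singleton, Prod.mk.injEq, not_or]
  constructor
  · rintro (((⟨a, h, rfl, rfl⟩ | ⟨a, h, rfl, rfl⟩) | ⟨a, h, rfl, rfl⟩) | ⟨a, h, rfl, rfl⟩) <;>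
      simp [h.1, h.2]
  · rintro ⟨h0, ⟨h, rfl⟩ | ⟨h, rfl⟩ | ⟨h, rfl⟩ | ⟨h, rfl⟩⟩
    · exact Or.inl (Or.inl (Or.inl ⟨ρ, ⟨h0, h⟩, rfl, rfl⟩))
    · exact Or.inl (Or.inl (Or.inr ⟨ρ, ⟨h0, h⟩, rfl, rfl⟩))
    · exact Or.inl (Or.inr ⟨ρ, ⟨h0, h⟩, rfl, rfl⟩)
    · exact Or.inr ⟨ρ, ⟨h0, h⟩, rfl, rfl⟩

/-- The excluded cells `(r + 1, e)` and `(r - 1, e + 1)` each lie on a column of the pair and on a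
symbol line of the other cell. They are adjacent to both cells, so alone they cause no red edge.
Removing both occurrences of each lowers `4(n - 1)` to `4n - 8`. -/
theorem mem_pairNeighbors {r e ρ d : ZMod n} (hρ : r ≠ ρ)
    (h : d = e ∨ d = e + 1 ∨ ρ + d = r + e ∨ ρ + d = r + e + 1)
    (hA : ¬ (ρ = r + 1 ∧ d = e)) (hB : ¬ (ρ = r - 1 ∧ d = e + 1)) :
    (ρ, d) ∈ pairNeighbors r e := by
  rw [mem_pairNeighbors_iff]
  grind

theorem succ_mem_pairNeighbors {r e : ZMod n} (h1 : (1 : ZMod n) ≠ 0) (h2 : (2 : ZMod n) ≠ 0) :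
    (r + 1, e + 1) ∈ pairNeighbors r e :=
  mem_pairNeighbors_iff.2 ⟨fun h => h1 (by linear_combination h),
    Or.inr (Or.inl ⟨fun h => h2 (by linear_combination h), rfl⟩)⟩

theorem pred_mem_pairNeighbors {r e : ZMod n} (h1 : (1 : ZMod n) ≠ 0) (h2 : (2 : ZMod n) ≠ 0) :
    (r - 1, e) ∈ pairNeighbors r e :=
  mem_pairNeighbors_iff.2 ⟨fun h => h1 (by linear_combination -h),
    Or.inl ⟨fun h => h2 (by linear_combination -h), rfl⟩⟩

/-- Columns are merged in pairs. -/
theorem chain_pair_columns (hn : 5 ≤ n) :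
    Relation.ReflTransGen ((cyclicLatinGraph n).MergeStep (4 * n - 8))
      (kerPartition (id : ZMod n × ZMod n → ZMod n × ZMod n))
      (kerPartition fun v : ZMod n × ZMod n => (v.1, v.2.val / 2)) := by
  have one_ne := zmod_one_ne_zero hn
  have two_ne := zmod_two_ne_zero hn
  refine SimpleGraph.chain_of_ker (fun x y h => by rw [id, id] at h; rw [h])
    fun P _ hP U hU => ?_
  simp only [Prod.mk.injEq] at hP
  by_cases hsub : ∃ x ∈ U, ∃ y ∈ U, x ≠ y
  · obtain ⟨⟨r, c⟩, hx, ⟨r', c'⟩, hy, hxy⟩ := hsub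
    obtain ⟨h1, h2⟩ := hP U hU _ hx _ hy
    simp only at h1 h2
    subst h1
    generalize hj : c.val / 2 = j at h2
    set e : ZMod n := 2 * (j : ZMod n) with he
    have hU' : ∀ z ∈ U, z = (r, e) ∨ z = (r, e + 1) := by
      intro z hz
      obtain ⟨h3, h4⟩ := hP U hU _ hx _ hz
      have := eq_or_eq_add_one_of_val_div_two (h4.symm.trans hj)
      rcases this with h | h
      · exact Or.inl (Prod.ext h3.symm h)
      · exact Or.inr (Prod.ext h3.symm h)
    have hmem : (r, e) ∈ U ∧ (r, e + 1) ∈ U := by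
      rcases hU' _ hx with h | h <;> rcases hU' _ hy with h' | h'
      · exact absurd (h.trans h'.symm) hxy
      · exact ⟨h ▸ hx, h' ▸ hy⟩
      · exact ⟨h' ▸ hy, h ▸ hx⟩
      · exact absurd (h.trans h'.symm) hxy
    have hpair : ∀ W ∈ P.parts, ∀ d : ZMod n, (d = e ∨ d = e + 1) → ∀ ρ, (ρ, d) ∈ W →
        ∀ z ∈ W, z = (ρ, e) ∨ z = (ρ, e + 1) := by
      intro W hW d hd ρ hρ z hz
      obtain ⟨h3, h4⟩ := hP W hW _ hρ _ hz
      have hdj : d.val / 2 = j := by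
        rcases hd with rfl | rfl
        · have := (hP U hU _ hx _ hmem.1).2
          exact this.symm.trans hj
        · have := (hP U hU _ hx _ hmem.2).2
          exact this.symm.trans hj
      rcases eq_or_eq_add_one_of_val_div_two (h4.symm.trans hdj) with h | h
      · exact Or.inl (Prod.ext h3.symm h)
      · exact Or.inr (Prod.ext h3.symm h)
    have hr1 : r ≠ r + 1 := fun h => one_ne (by simpa using h)
    have hr2 : r ≠ r - 1 := fun h => one_ne (sub_eq_self.1 h.symm)
    refine ⟨pairNeighbors r e, card_pairNeighbors_le (by omega) hr1 hr2, ?_⟩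
    · rintro W hW hUW ⟨⟨x, hxU, ⟨ρ, d⟩, hw, hadj⟩, ⟨x', hxU', ⟨ρ', d'⟩, hw', hadj'⟩⟩
      have hρ' := (hP W hW _ hw _ hw').1
      simp only at hρ'
      subst hρ'
      -- Parts in the same row are fully connected, so never mixed.
      have hρ : r ≠ ρ := by
        rintro rfl
        refine hadj' ⟨?_, Or.inl ?_⟩
        · intro h
          exact hUW (P.eq_of_mem_parts hU hW hxU' (h ▸ hw'))
        · rcases hU' _ hxU' with rfl | rfl <;> rfl
      have hline : d = e ∨ d = e + 1 ∨ ρ + d = r + e ∨ ρ + d = r + e + 1 := by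
        obtain ⟨-, h⟩ := hadj
        rcases hU' _ hxU with rfl | rfl
        · rcases h with h | h | h
          · exact absurd h hρ
          · exact Or.inl h.symm
          · exact Or.inr (Or.inr (Or.inl h.symm))
        · rcases h with h | h | h
          · exact absurd h hρ
          · exact Or.inr (Or.inl h.symm)
          · exact Or.inr (Or.inr (Or.inr (h.symm.trans (add_assoc _ _ _).symm)))
      -- This cell is adjacent to all of `U`, so the nonadjacent cell of `W` is its partner, which
      -- is a listed label.
      by_cases hA : ρ = r + 1 ∧ d = e
      · obtain ⟨rfl, rfl⟩ := hA
        refine ⟨(r + 1, e + 1), ?_, succ_mem_pairNeighbors one_ne two_ne⟩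
        rcases hpair W hW _ (Or.inl rfl) _ hw _ hw' with h | h
        · exfalso
          rw [h] at hadj'
          refine hadj' ⟨fun h => hρ ?_, ?_⟩
          · rcases hU' _ hxU' with rfl | rfl <;> exact congrArg Prod.fst h
          · rcases hU' _ hxU' with rfl | rfl
            · exact Or.inr (Or.inl rfl)
            · refine Or.inr (Or.inr ?_)
              change r + (e + 1) = r + 1 + e
              ring
        · exact h ▸ hw'
      by_cases hB : ρ = r - 1 ∧ d = e + 1
      · obtain ⟨rfl, rfl⟩ := hB
        refine ⟨(r - 1, e), ?_, pred_mem_pairNeighbors one_ne two_ne⟩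
        rcases hpair W hW _ (Or.inr rfl) _ hw _ hw' with h | h
        · exact h ▸ hw'
        · exfalso
          rw [h] at hadj'
          refine hadj' ⟨fun h => hρ ?_, ?_⟩
          · rcases hU' _ hxU' with rfl | rfl <;> exact congrArg Prod.fst h
          · rcases hU' _ hxU' with rfl | rfl
            · refine Or.inr (Or.inr ?_)
              change r + e = r - 1 + (e + 1)
              ring
            · exact Or.inr (Or.inl rfl)
      exact ⟨(ρ, d), hw, mem_pairNeighbors hρ hline hA hB⟩
  -- A singleton has red neighbours only along its column and its symbol: at most `2(n - 1)`.
  · push Not at hsub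
    obtain ⟨⟨r, c⟩, hu⟩ := P.nonempty_of_mem_parts hU
    refine ⟨((univ.erase r).image fun t => (t, c)) ∪
      ((univ.erase r).image fun t => (t, r + c - t)), ?_, ?_⟩
    · refine (card_union_le _ _).trans ?_
      have h1 := card_image_erase (fun t : ZMod n => (t, c)) r
      have h2 := card_image_erase (fun t : ZMod n => (t, r + c - t)) r
      omega
    · rintro W hW hUW ⟨⟨x, hxU, ⟨ρ, d⟩, hw, hadj⟩, ⟨x', hxU', ⟨ρ', d'⟩, hw', hadj'⟩⟩
      obtain rfl := hsub _ hu _ hxU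
      obtain rfl := hsub _ hu _ hxU'
      have hρ' := (hP W hW _ hw _ hw').1
      simp only at hρ'
      subst hρ'
      have hρ : r ≠ ρ := by
        rintro rfl
        exact hadj' ⟨fun h => hUW (P.eq_of_mem_parts hU hW hxU' (h ▸ hw')), Or.inl rfl⟩
      refine ⟨(ρ, d), hw, ?_⟩
      simp only [mem_union, mem_image, mem_erase, mem_univ, and_true, Prod.mk.injEq, id]
      obtain ⟨-, h | h | h⟩ := hadj
      · exact absurd h hρ
      · exact Or.inl ⟨ρ, hρ.symm, rfl, h⟩
      · refine Or.inr ⟨ρ, hρ.symm, rfl, ?_⟩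
        change r + c = ρ + d at h
        rw [h]
        ring

end Stages

/-! ### Second stage: pairing the rows -/

theorem two_mul_eq_neg_one {n m : ℕ} (hm : n = 2 * m + 1) : (2 : ZMod n) * m = -1 := by
  have h : ((2 * m + 1 : ℕ) : ZMod n) = 0 := by rw [← hm, ZMod.natCast_self]
  push_cast at h
  exact eq_neg_of_add_eq_zero_left h

section Blocks

variable {n : ℕ} [NeZero n]

/-- The rows in which a pair of columns with index `j` can contain a neighbour of the block with
rows `e`, `e + 1` and column index `J`. -/
def meetingRows (e : ZMod n) (J j : ℕ) : Finset (ZMod n) :=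
  univ.filter fun ρ => ρ = e ∨ ρ = e + 1 ∨
    ∃ x y : ZMod n, x.val / 2 = J ∧ y.val / 2 = j ∧ (e + x = ρ + y ∨ e + 1 + x = ρ + y)

theorem mem_meetingRows {e ρ : ZMod n} {J j : ℕ} : ρ ∈ meetingRows e J j ↔ ρ = e ∨ ρ = e + 1 ∨
    ∃ x y : ZMod n, x.val / 2 = J ∧ y.val / 2 = j ∧ (e + x = ρ + y ∨ e + 1 + x = ρ + y) := by
  simp [meetingRows]

/-- A row offset in `{0, 1}` plus a difference of two column offsets in `{-1, 0, 1}` gives the four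
rows from `d - 1` to `d + 2`. A group consisting of one column loses one end of this range. -/
theorem eq_of_mem_meetingRows {e ρ d : ZMod n} {J j : ℕ} (hd : d = e + 2 * J - 2 * j)
    (h : ρ ∈ meetingRows e J j) :
    ρ = e ∨ ρ = e + 1 ∨ ρ = d - 1 ∨ ρ = d ∨ ρ = d + 1 ∨ ρ = d + 2 := by
  rcases mem_meetingRows.1 h with h | h | ⟨x, y, hx, hy, h⟩
  · exact Or.inl h
  · exact Or.inr (Or.inl h)
  · have hx := eq_or_eq_add_one_of_val_div_two hx
    have hy := eq_or_eq_add_one_of_val_div_two hy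
    grind

theorem eq_of_mem_meetingRows_of_last {e ρ d : ZMod n} {J j : ℕ} (hd : d = e + 2 * J - 2 * j)
    (hj : ∀ y : ZMod n, y.val / 2 = j → y = 2 * j) (h : ρ ∈ meetingRows e J j) :
    ρ = e ∨ ρ = e + 1 ∨ ρ = d ∨ ρ = d + 1 ∨ ρ = d + 2 := by
  rcases mem_meetingRows.1 h with h | h | ⟨x, y, hx, hy, h⟩
  · exact Or.inl h
  · exact Or.inr (Or.inl h)
  · have hx := eq_or_eq_add_one_of_val_div_two hx
    have hy := hj y hy
    clear hj
    grind

theorem eq_of_mem_meetingRows_of_first {e ρ d : ZMod n} {J j : ℕ} (hd : d = e + 2 * J - 2 * j)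
    (hJ : ∀ y : ZMod n, y.val / 2 = J → y = 2 * J) (h : ρ ∈ meetingRows e J j) :
    ρ = e ∨ ρ = e + 1 ∨ ρ = d - 1 ∨ ρ = d ∨ ρ = d + 1 := by
  rcases mem_meetingRows.1 h with h | h | ⟨x, y, hx, hy, h⟩
  · exact Or.inl h
  · exact Or.inr (Or.inl h)
  · have hx := hJ x hx
    have hy := eq_or_eq_add_one_of_val_div_two hy
    clear hJ
    grind

theorem card_meetingRows_le (e : ZMod n) (J j : ℕ) : (meetingRows e J j).card ≤ 6 := by
  set d := e + 2 * (J : ZMod n) - 2 * j with hd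
  refine (card_le_card (t := {e, e + 1, d - 1, d, d + 1, d + 2}) fun ρ h => ?_).trans card_le_six
  simpa using eq_of_mem_meetingRows hd h

/-- For neighbouring column pairs the four symbol rows overlap `{e, e + 1}`, which saves one row. -/
theorem card_meetingRows_right (e : ZMod n) (J : ℕ) : (meetingRows e J (J + 1)).card ≤ 5 := by
  refine (card_le_card (t := {e, e + 1, e - 2 - 1, e - 2, e - 2 + 1}) fun ρ h => ?_).trans
    card_le_five
  have := eq_of_mem_meetingRows (d := e - 2) (by push_cast; ring) h
  simp only [mem_insert, mem_singleton]
  grind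

theorem card_meetingRows_left (e : ZMod n) (j : ℕ) : (meetingRows e (j + 1) j).card ≤ 5 := by
  refine (card_le_card (t := {e, e + 1, e + 2, e + 2 + 1, e + 2 + 2}) fun ρ h => ?_).trans
    card_le_five
  have := eq_of_mem_meetingRows (d := e + 2) (by push_cast; ring) h
  simp only [mem_insert, mem_singleton]
  grind

theorem eq_of_val_div_two_last {m : ℕ} (hm : n = 2 * m + 1) (y : ZMod n) (hy : y.val / 2 = m) : y = 2 * m := by
  have h1 := y.val_lt
  have h2 : y.val = 2 * m := by omega
  rw [← ZMod.natCast_zmod_val y, h2]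
  push_cast
  rfl

theorem card_meetingRows_last {m : ℕ} (hm : n = 2 * m + 1) (e : ZMod n) (J : ℕ) : (meetingRows e J m).card ≤ 5 := by
  set d := e + 2 * (J : ZMod n) - 2 * m with hd
  refine (card_le_card (t := {e, e + 1, d, d + 1, d + 2}) fun ρ h => ?_).trans card_le_five
  simpa using eq_of_mem_meetingRows_of_last hd (eq_of_val_div_two_last hm) h

theorem card_meetingRows_first {m : ℕ} (hm : n = 2 * m + 1) (e : ZMod n) (j : ℕ) : (meetingRows e m j).card ≤ 5 := by
  set d := e + 2 * (m : ZMod n) - 2 * j with hd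
  refine (card_le_card (t := {e, e + 1, d - 1, d, d + 1}) fun ρ h => ?_).trans card_le_five
  simpa using eq_of_mem_meetingRows_of_first hd (eq_of_val_div_two_last hm) h

theorem card_meetingRows_right_last {m : ℕ} (hm : n = 2 * m + 1) (e : ZMod n) {J : ℕ} (hJ : J + 1 = m) :
    (meetingRows e J m).card ≤ 4 := by
  refine (card_le_card (t := {e, e + 1, e - 2, e - 2 + 1}) fun ρ h => ?_).trans card_le_four
  have := eq_of_mem_meetingRows_of_last (d := e - 2) (by rw [← hJ]; push_cast; ring)
    (eq_of_val_div_two_last hm) h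
  simp only [mem_insert, mem_singleton]
  grind

theorem card_meetingRows_zero_last {m : ℕ} (hm : n = 2 * m + 1) (e : ZMod n) : (meetingRows e 0 m).card ≤ 4 := by
  refine (card_le_card (t := {e, e + 1, e + 1 + 1, e + 1 + 2}) fun ρ h => ?_).trans card_le_four
  -- Since `2m = -1`, the last column is the cyclic left neighbour of column pair `0`.
  have := eq_of_mem_meetingRows_of_last (d := e + 1) (by
    rw [two_mul_eq_neg_one hm]
    push_cast
    ring) (eq_of_val_div_two_last hm) h
  simp only [mem_insert, mem_singleton]
  grind

theorem card_meetingRows_first_left {m : ℕ} (hm : n = 2 * m + 1) (e : ZMod n) {j : ℕ} (hj : j + 1 = m) :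
    (meetingRows e m j).card ≤ 4 := by
  refine (card_le_card (t := {e, e + 1, e + 2, e + 2 + 1}) fun ρ h => ?_).trans card_le_four
  have := eq_of_mem_meetingRows_of_first (d := e + 2) (by rw [← hj]; push_cast; ring)
    (eq_of_val_div_two_last hm) h
  simp only [mem_insert, mem_singleton]
  grind

/-- Each indicator is one saved row: for the single last column, for the right neighbour of `J`, and
for its cyclic left neighbour. The savings add up when they fall on the same `j`. -/
theorem card_meetingRows_add_le {m : ℕ} (hm : n = 2 * m + 1) (hm2 : 2 ≤ m) (e : ZMod n) {J j : ℕ} (hJ : J < m) (hj : j ≤ m)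
    (hjJ : j ≠ J) : (meetingRows e J j).card + (if j = m then 1 else 0) +
      (if j = J + 1 then 1 else 0) + (if j = if J = 0 then m else J - 1 then 1 else 0) ≤ 6 := by
  by_cases hjm : j = m
  · subst hjm
    by_cases h0 : J = 0
    · subst h0
      have := card_meetingRows_zero_last hm e
      rw [if_pos rfl, if_neg (by omega), if_pos rfl, if_pos rfl]
      omega
    by_cases h1 : J + 1 = j
    · have := card_meetingRows_right_last hm e h1
      rw [if_pos rfl, if_pos h1.symm, if_neg h0, if_neg (by omega)]
      omega
    · have := card_meetingRows_last hm e J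
      rw [if_pos rfl, if_neg (by omega), if_neg h0, if_neg (by omega)]
      omega
  by_cases h1 : j = J + 1
  · have := card_meetingRows_right e J
    rw [← h1] at this
    rw [if_neg hjm, if_pos h1, if_neg]
    · omega
    · split_ifs <;> omega
  by_cases h2 : j + 1 = J
  · have := card_meetingRows_left e j
    rw [h2] at this
    rw [if_neg hjm, if_neg h1]
    split_ifs <;> omega
  · have := card_meetingRows_le e J j
    rw [if_neg hjm, if_neg h1]
    split_ifs <;> omega

/-- For `J < m` the three savings are subtracted from `6m`. For `J = m` the block itself has one
column, and `5m - 1 ≤ 6m - 3` because `m ≥ 2`. -/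
theorem sum_card_meetingRows_odd {m : ℕ} (hm : n = 2 * m + 1) (hm2 : 2 ≤ m) (e : ZMod n) {J : ℕ} (hJ : J < m + 1) :
    ∑ j ∈ (range (m + 1)).erase J, (meetingRows e J j).card ≤ 6 * m - 3 := by
  have hs : ((range (m + 1)).erase J).card = m := by
    rw [card_erase_of_mem (mem_range.2 hJ), card_range, Nat.add_sub_cancel]
  rcases (Nat.lt_succ_iff.1 hJ).lt_or_eq with hJm | rfl
  · have h := sum_le_card_nsmul ((range (m + 1)).erase J) (fun j => (meetingRows e J j).card +
        (if j = m then 1 else 0) + (if j = J + 1 then 1 else 0) +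
        (if j = if J = 0 then m else J - 1 then 1 else 0)) 6 (fun j hj => by
      rw [mem_erase, mem_range] at hj
      exact card_meetingRows_add_le hm hm2 e hJm (by omega) hj.1)
    rw [sum_add_distrib, sum_add_distrib, sum_add_distrib, sum_ite_eq', sum_ite_eq', sum_ite_eq',
      hs, if_pos (by rw [mem_erase, mem_range]; omega),
      if_pos (by rw [mem_erase, mem_range]; omega),
      if_pos (by rw [mem_erase, mem_range]; split_ifs <;> omega), smul_eq_mul] at h
    omega
  · have h := sum_le_card_nsmul ((range (J + 1)).erase J) (fun j => (meetingRows e J j).card +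
        (if j = J - 1 then 1 else 0)) 5 (fun j hj => by
      by_cases hj1 : j = J - 1
      · have := card_meetingRows_first_left hm e (j := j) (by omega)
        rw [if_pos hj1]
        omega
      · rw [if_neg hj1]
        exact card_meetingRows_first hm e j)
    rw [sum_add_distrib, sum_ite_eq', hs, if_pos (by rw [mem_erase, mem_range]; omega),
      smul_eq_mul] at h
    omega

theorem sum_card_meetingRows (hn : 5 ≤ n) (e : ZMod n) {J : ℕ} (hJ : J < (n - 1) / 2 + 1) :
    ∑ j ∈ (range ((n - 1) / 2 + 1)).erase J, (meetingRows e J j).card ≤ 3 * n - 6 := by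
  rcases Nat.even_or_odd' n with ⟨m, hm | hm⟩
  · have h := sum_le_card_nsmul ((range ((n - 1) / 2 + 1)).erase J)
      (fun j => (meetingRows e J j).card) 6 fun j _ => card_meetingRows_le e J j
    rw [card_erase_of_mem (mem_range.2 hJ), card_range, smul_eq_mul] at h
    omega
  · have hm' : (n - 1) / 2 = m := by omega
    rw [hm'] at hJ ⊢
    have := sum_card_meetingRows_odd hm (by omega) e hJ
    omega

/-- After the columns, the rows are merged in pairs. -/
theorem chain_pair_rows (hn : 5 ≤ n) :
    Relation.ReflTransGen ((cyclicLatinGraph n).MergeStep (4 * n - 8))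
      (kerPartition fun v : ZMod n × ZMod n => (v.1, v.2.val / 2))
      (kerPartition fun v : ZMod n × ZMod n => (v.1.val / 2, v.2.val / 2)) := by
  have one_ne := zmod_one_ne_zero hn
  refine SimpleGraph.chain_of_ker (fun x y h => ?_) fun P hF hP U hU => ?_
  · simp only [Prod.mk.injEq] at h ⊢
    exact ⟨by rw [h.1], h.2⟩
  simp only [Prod.mk.injEq] at hF hP
  obtain ⟨u, hu⟩ := P.nonempty_of_mem_parts hU
  have hJlt := val_div_lt u.2 2
  generalize hJ : u.2.val / 2 = J at hJlt
  have hUJ : ∀ x ∈ U, x.2.val / 2 = J := fun x hx => (hP U hU x hx u hu).2.trans hJ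
  have hout : ∀ W ∈ P.parts, U ≠ W → ∀ w ∈ W, w.2.val / 2 = J → ∀ x ∈ U, w.1 ≠ x.1 := by
    intro W hW hUW w hw hwJ x hx h
    exact hUW (P.eq_of_mem_parts hU hW
      (hF x w ⟨h.symm, (hUJ x hx).trans hwJ.symm⟩ U hU hx) hw)
  by_cases hrow : ∃ x ∈ U, ∃ y ∈ U, x.1 ≠ y.1
  · obtain ⟨x, hx, y, hy, hxy⟩ := hrow
    have hi := (hP U hU x hx y hy).1
    generalize hxi : x.1.val / 2 = i at hi
    set e : ZMod n := 2 * (i : ZMod n) with he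
    have hUe : ∀ z ∈ U, z.1 = e ∨ z.1 = e + 1 := fun z hz =>
      eq_or_eq_add_one_of_val_div_two ((hP U hU z hz x hx).1.trans hxi)
    have hmem : (∃ z ∈ U, z.1 = e) ∧ ∃ z ∈ U, z.1 = e + 1 := by
      rcases hUe x hx with h | h <;> rcases hUe y hy with h' | h'
      · exact absurd (h.trans h'.symm) hxy
      · exact ⟨⟨x, hx, h⟩, ⟨y, hy, h'⟩⟩
      · exact ⟨⟨y, hy, h'⟩, ⟨x, hx, h⟩⟩
      · exact absurd (h.trans h'.symm) hxy
    -- At most `n - 2` labels in the same column group and `3n - 6` in the others: exactly `4n - 8`.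
    refine ⟨((univ \ {e, e + 1}).image fun t => (t, J)) ∪
      ((range ((n - 1) / 2 + 1)).erase J).biUnion fun j =>
        (meetingRows e J j).image fun t => (t, j), ?_, ?_⟩
    · refine (card_union_le _ _).trans ?_
      have h1 := card_image_sdiff_pair (fun t : ZMod n => (t, J)) (a := e) (b := e + 1)
        (fun h => one_ne (by simpa using h))
      have h2 : (((range ((n - 1) / 2 + 1)).erase J).biUnion fun j =>
          (meetingRows e J j).image fun t => (t, j)).card ≤ 3 * n - 6 :=
        card_biUnion_le.trans ((sum_le_sum fun j _ => card_image_le).trans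
          (sum_card_meetingRows hn e hJlt))
      omega
    · rintro W hW hUW ⟨⟨z, hz, w, hw, -, hadj⟩, -⟩
      refine ⟨w, hw, ?_⟩
      simp only [mem_union, mem_biUnion, mem_image, mem_sdiff, mem_univ, true_and, mem_insert,
        mem_singleton, mem_erase, mem_range]
      by_cases hwJ : w.2.val / 2 = J
      · refine Or.inl ⟨w.1, ?_, by rw [hwJ]⟩
        obtain ⟨⟨z1, hz1, h1⟩, z2, hz2, h2⟩ := hmem
        rintro (h | h)
        · exact hout W hW hUW w hw hwJ z1 hz1 (h.trans h1.symm)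
        · exact hout W hW hUW w hw hwJ z2 hz2 (h.trans h2.symm)
      · refine Or.inr ⟨w.2.val / 2, ⟨hwJ, val_div_lt w.2 2⟩, w.1, mem_meetingRows.2 ?_, rfl⟩
        rcases hadj with h | h | h
        · rcases hUe z hz with h' | h'
          · exact Or.inl (h.symm.trans h')
          · exact Or.inr (Or.inl (h.symm.trans h'))
        · exact absurd (h ▸ hUJ z hz) hwJ
        · change z.1 + z.2 = w.1 + w.2 at h
          refine Or.inr (Or.inr ⟨z.2, w.2, hUJ z hz, rfl, ?_⟩)
          rcases hUe z hz with h' | h' <;> rw [h'] at h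
          exacts [Or.inl h, Or.inr h]
  · push Not at hrow
    generalize hr : u.1 = r
    have hUr : ∀ x ∈ U, x.1 = r := fun x hx => (hrow x hx u hu).trans hr
    -- A part in a single row meets at most four rows of each other column group; `3n - 3 ≤ 4n - 8`
    -- needs `n ≥ 5`.
    refine ⟨((univ.erase r).image fun t => (t, J)) ∪
      ((range ((n - 1) / 2 + 1)).erase J).biUnion fun j =>
        ({r, r + 2 * J - 2 * j - 1, r + 2 * J - 2 * j, r + 2 * J - 2 * j + 1} :
          Finset (ZMod n)).image fun t => (t, j), ?_, ?_⟩
    · refine (card_union_le _ _).trans ?_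
      have h1 := card_image_erase (fun t : ZMod n => (t, J)) r
      have h2 := card_biUnion_le_card_mul ((range ((n - 1) / 2 + 1)).erase J) (fun j =>
        ({r, r + 2 * J - 2 * j - 1, r + 2 * J - 2 * j, r + 2 * J - 2 * j + 1} :
          Finset (ZMod n)).image fun t => (t, j)) 4 fun j _ => card_image_le.trans card_le_four
      rw [card_erase_of_mem (mem_range.2 hJlt), card_range] at h2
      omega
    · rintro W hW hUW ⟨⟨z, hz, w, hw, -, hadj⟩, -⟩
      refine ⟨w, hw, ?_⟩
      simp only [mem_union, mem_biUnion, mem_image, mem_erase, mem_univ, and_true, mem_insert,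
        mem_singleton, mem_range]
      by_cases hwJ : w.2.val / 2 = J
      · exact Or.inl ⟨w.1, fun h => hout W hW hUW w hw hwJ u hu (h.trans hr.symm), by rw [hwJ]⟩
      · refine Or.inr ⟨w.2.val / 2, ⟨hwJ, val_div_lt w.2 2⟩, w.1, ?_, rfl⟩
        rcases hadj with h | h | h
        · exact Or.inl (h.symm.trans (hUr z hz))
        · exact absurd (h ▸ hUJ z hz) hwJ
        · change z.1 + z.2 = w.1 + w.2 at h
          rw [hUr z hz] at h
          have h1 := eq_or_eq_add_one_of_val_div_two (hUJ z hz)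
          have h2 := eq_or_eq_add_one_of_val_div_two (x := w.2) rfl
          clear hF hP hout hrow hUr hUJ
          generalize w.2.val / 2 = j at h2 ⊢
          generalize w.1 = ρ at h ⊢
          generalize w.2 = b at h h2
          generalize z.2 = a at h h1
          clear hw hz hW hU hu hJ hr
          grind

end Blocks

/-! ### Third stage: doubling the column groups -/

section Doubling

variable {n : ℕ} [NeZero n]

theorem val_add_natCast_of_lt {D : ZMod n} {t : ℕ} (h : D.val + t < n) :
    (D + (t : ZMod n)).val = D.val + t := by
  rw [ZMod.val_add, ZMod.val_natCast, Nat.add_mod_mod, Nat.mod_eq_of_lt h]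

theorem val_add_natCast_of_le {D : ZMod n} {t : ℕ} (h : n ≤ D.val + t) (h' : D.val + t < 2 * n) :
    (D + (t : ZMod n)).val = D.val + t - n := by
  rw [ZMod.val_add, ZMod.val_natCast, Nat.add_mod_mod, Nat.mod_eq_sub_mod h,
    Nat.mod_eq_of_lt (by omega)]

/-- Among four cyclically consecutive rows, two consecutive ones form a pair. -/
theorem exists_consecutive_pair (hn : 5 ≤ n) (D : ZMod n) :
    ∃ t : ℕ, t < 3 ∧ (D + (t : ZMod n)).val / 2 = (D + ((t + 1 : ℕ) : ZMod n)).val / 2 := by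
  have hD := D.val_lt
  rcases Nat.even_or_odd' D.val with ⟨k, hk | hk⟩
  · by_cases h : D.val + 1 < n
    · refine ⟨0, by omega, ?_⟩
      rw [val_add_natCast_of_lt (t := 0) (by omega),
        val_add_natCast_of_lt (t := 0 + 1) (by omega)]
      omega
    · refine ⟨1, by omega, ?_⟩
      rw [val_add_natCast_of_le (t := 1) (by omega) (by omega),
        val_add_natCast_of_le (t := 1 + 1) (by omega) (by omega)]
      omega
  · by_cases h : D.val + 2 < n
    · refine ⟨1, by omega, ?_⟩
      rw [val_add_natCast_of_lt (t := 1) (by omega),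
        val_add_natCast_of_lt (t := 1 + 1) (by omega)]
      omega
    -- Here `n` is odd and row `n - 1`, which has no partner, comes second; the pair is formed by
    -- rows `0` and `1` after wrapping around. This is why four rows are needed.
    by_cases h' : D.val + 1 < n
    · refine ⟨2, by omega, ?_⟩
      rw [val_add_natCast_of_le (t := 2) (by omega) (by omega),
        val_add_natCast_of_le (t := 2 + 1) (by omega) (by omega)]
      omega
    · refine ⟨1, by omega, ?_⟩
      rw [val_add_natCast_of_le (t := 1) (by omega) (by omega),
        val_add_natCast_of_le (t := 1 + 1) (by omega) (by omega)]
      omega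

theorem card_image_val_div_two (hn : 5 ≤ n) (D : ZMod n) {L : ℕ} (hL : 4 ≤ L) :
    ((range L).image fun t : ℕ => (D + (t : ZMod n)).val / 2).card ≤ L - 1 := by
  obtain ⟨t, ht, h⟩ := exists_consecutive_pair hn D
  have hsub : ((range L).image fun t : ℕ => (D + (t : ZMod n)).val / 2) ⊆
      ((range L).erase (t + 1)).image fun t : ℕ => (D + (t : ZMod n)).val / 2 := by
    intro k hk
    obtain ⟨s, hs, rfl⟩ := mem_image.1 hk
    rw [mem_range] at hs
    by_cases hst : s = t + 1
    · exact mem_image.2 ⟨t, mem_erase.2 ⟨by omega, mem_range.2 (by omega)⟩, by rw [hst]; exact h⟩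
    · exact mem_image.2 ⟨s, mem_erase.2 ⟨hst, mem_range.2 hs⟩, rfl⟩
  refine (card_le_card hsub).trans (card_image_le.trans ?_)
  rw [card_erase_of_mem (mem_range.2 (by omega)), card_range]

/-- The row indices in which the group of `b` columns with index `j` can contain a neighbour of the
block with row index `i` and index `J` of a group of `2 * b` columns. -/
def meetingBlocks (n : ℕ) [NeZero n] (i b J j : ℕ) : Finset ℕ :=
  (range ((n - 1) / 2 + 1)).filter fun k => k = i ∨ ∃ r ρ x y : ZMod n,
    r.val / 2 = i ∧ ρ.val / 2 = k ∧ x.val / b / 2 = J ∧ y.val / b = j ∧ r + x = ρ + y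

/-- Two rows, `m` columns and `b` columns produce `m + b` consecutive rows starting at `D`. Two of
them share a row index, and this saving compensates for the extra index `i`. -/
theorem card_meetingBlocks_le (hn : 5 ≤ n) (i j : ℕ) {b J m : ℕ} (hb : 2 ≤ b) (hm : 2 ≤ m)
    (lo : ZMod n) (h : ∀ x : ZMod n, x.val / b / 2 = J → ∃ s < m, x = lo + (s : ZMod n)) :
    (meetingBlocks n i b J j).card ≤ m + b := by
  set D : ZMod n := 2 * (i : ZMod n) + lo - b * j - (b - 1) with hD
  have hsub : meetingBlocks n i b J j ⊆
      insert i ((range (m + b)).image fun t : ℕ => (D + (t : ZMod n)).val / 2) := by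
    intro k hk
    simp only [meetingBlocks, mem_filter] at hk
    obtain ⟨-, rfl | ⟨r, ρ, x, y, hr, hρ, hx, hy, hxy⟩⟩ := hk
    · exact mem_insert_self _ _
    obtain ⟨s, hs, hx⟩ := h x hx
    obtain ⟨t, ht, hy'⟩ := exists_offset (by omega : 0 < b) y
    obtain ⟨a, ha, hr'⟩ := exists_offset two_pos r
    refine mem_insert_of_mem (mem_image.2 ⟨a + s + (b - 1 - t), mem_range.2 (by omega), ?_⟩)
    rw [← hρ]
    congr 2
    rw [hr] at hr'
    rw [hy] at hy'
    rw [Nat.sub_sub]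
    push_cast [Nat.cast_sub (by omega : 1 + t ≤ b)] at hr' hy' ⊢
    rw [hr', hx, hy'] at hxy
    rw [hD]
    linear_combination hxy
  have := (card_le_card hsub).trans (card_insert_le _ _)
  have h2 := card_image_val_div_two hn D (L := m + b) (by omega)
  omega

/-- Groups of `b` columns are merged in pairs. -/
theorem chain_double_columns (hn : 5 ≤ n) {b : ℕ} (hb : 2 ≤ b) :
    Relation.ReflTransGen ((cyclicLatinGraph n).MergeStep (4 * n - 8))
      (kerPartition fun v : ZMod n × ZMod n => (v.1.val / 2, v.2.val / b))
      (kerPartition fun v : ZMod n × ZMod n => (v.1.val / 2, v.2.val / b / 2)) := by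
  refine SimpleGraph.chain_of_ker (fun x y h => ?_) fun P hF hP U hU => ?_
  · simp only [Prod.mk.injEq] at h ⊢
    exact ⟨h.1, by rw [h.2]⟩
  simp only [Prod.mk.injEq] at hP
  obtain ⟨u, hu⟩ := P.nonempty_of_mem_parts hU
  have hulq := val_div_lt u.2 b
  generalize hi : u.1.val / 2 = i
  generalize hJ : u.2.val / b / 2 = J
  have hUJ : ∀ x ∈ U, x.1.val / 2 = i ∧ x.2.val / b / 2 = J := fun x hx =>
    ⟨(hP U hU x hx u hu).1.trans hi, (hP U hU x hx u hu).2.trans hJ⟩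
  have hmeet : ∀ z ∈ U, ∀ w, (cyclicLatinGraph n).Adj z w → w.2.val / b / 2 ≠ J →
      w.1.val / 2 ∈ meetingBlocks n i b J (w.2.val / b) := by
    rintro z hz w ⟨-, hadj⟩ hw
    obtain ⟨h1, h2⟩ := hUJ z hz
    refine mem_filter.2 ⟨mem_range.2 (val_div_lt w.1 2), ?_⟩
    rcases hadj with h | h | h
    · exact Or.inl (h ▸ h1)
    · exact absurd (h ▸ h2) hw
    · exact Or.inr ⟨z.1, w.1, z.2, w.2, h1, rfl, h2, rfl, h⟩
  have hbq : (n - 1) / b * b ≤ n - 1 := Nat.div_mul_le_self _ _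
  by_cases hlast : 2 * J + 1 < (n - 1) / b + 1
  · have hcard : ∀ j, (meetingBlocks n i b J j).card ≤ 2 * b + b := fun j => by
      refine card_meetingBlocks_le hn i j hb (by omega) ((2 * b * J : ℕ) : ZMod n) fun x hx => ?_
      obtain ⟨s, hs, h⟩ := exists_offset (by omega : 0 < 2 * b) x
      rw [mul_comm 2 b, ← Nat.div_div_eq_div_mul, hx, mul_comm b 2] at h
      exact ⟨s, hs, by rw [← Nat.cast_add]; exact h⟩
    -- The same doubled group contributes at most `n + 1` labels and the others at most `3(n - 1 -
    -- b)`; the sum is at most `4n - 8` because `b ≥ 2`.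
    refine ⟨((range ((n - 1) / 2 + 1)) ×ˢ {2 * J, 2 * J + 1}) ∪
      (((range ((n - 1) / b + 1)).erase (2 * J)).erase (2 * J + 1)).biUnion fun j =>
        (meetingBlocks n i b J j).image fun t => (t, j), ?_, ?_⟩
    · refine (card_union_le _ _).trans ?_
      have h2 := card_biUnion_le_card_mul
        (((range ((n - 1) / b + 1)).erase (2 * J)).erase (2 * J + 1))
        (fun j => (meetingBlocks n i b J j).image fun t => (t, j)) (2 * b + b)
        fun j _ => card_image_le.trans (hcard j)
      rw [card_erase_of_mem (mem_erase.2 ⟨by omega, mem_range.2 hlast⟩),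
        card_erase_of_mem (mem_range.2 (by omega)), card_range] at h2
      rw [card_product, card_range, card_pair (by omega)]
      obtain ⟨k, hk⟩ : ∃ k, (n - 1) / b = k + 1 := ⟨(n - 1) / b - 1, by omega⟩
      rw [hk] at h2 hbq ⊢
      have h3 : (k + 1 + 1 - 1 - 1) * (2 * b + b) = 3 * (k * b) := by
        rw [Nat.add_sub_cancel, Nat.add_sub_cancel]
        ring
      have h4 : (k + 1) * b = k * b + b := by ring
      omega
    · rintro W hW hUW ⟨⟨z, hz, w, hw, hadj⟩, -⟩
      refine ⟨w, hw, ?_⟩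
      simp only [mem_union, mem_product, mem_biUnion, mem_image, mem_insert,
        mem_singleton, mem_erase, mem_range]
      by_cases hwJ : w.2.val / b / 2 = J
      · exact Or.inl ⟨val_div_lt w.1 2, by omega⟩
      · exact Or.inr ⟨w.2.val / b, ⟨by omega, by omega, val_div_lt w.2 b⟩, _,
          hmeet z hz w hadj hwJ, rfl⟩
  -- The last group has no partner when the number of groups is odd, so the block has only `b`
  -- columns.
  · have hcol : ∀ x : ZMod n, x.val / b / 2 = J → x.val / b = 2 * J := fun x hx => by
      have := val_div_lt x b
      omega
    have hcard : ∀ j, (meetingBlocks n i b J j).card ≤ b + b := fun j => by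
      refine card_meetingBlocks_le hn i j hb hb ((b * (2 * J) : ℕ) : ZMod n) fun x hx => ?_
      obtain ⟨s, hs, h⟩ := exists_offset (by omega : 0 < b) x
      rw [hcol x hx] at h
      exact ⟨s, hs, by rw [← Nat.cast_add]; exact h⟩
    refine ⟨((range ((n - 1) / 2 + 1)) ×ˢ {2 * J}) ∪
      ((range ((n - 1) / b + 1)).erase (2 * J)).biUnion fun j =>
        (meetingBlocks n i b J j).image fun t => (t, j), ?_, ?_⟩
    · refine (card_union_le _ _).trans ?_
      have h2 := card_biUnion_le_card_mul ((range ((n - 1) / b + 1)).erase (2 * J))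
        (fun j => (meetingBlocks n i b J j).image fun t => (t, j)) (b + b)
        fun j _ => card_image_le.trans (hcard j)
      rw [card_erase_of_mem (mem_range.2 (by omega)), card_range, Nat.add_sub_cancel, mul_add]
        at h2
      rw [card_product, card_range, card_singleton]
      omega
    · rintro W hW hUW ⟨⟨z, hz, w, hw, hadj⟩, -⟩
      refine ⟨w, hw, ?_⟩
      simp only [mem_union, mem_product, mem_biUnion, mem_image, mem_singleton, mem_erase,
        mem_range]
      by_cases hwJ : w.2.val / b / 2 = J
      · exact Or.inl ⟨val_div_lt w.1 2, hcol _ hwJ⟩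
      · exact Or.inr ⟨w.2.val / b, ⟨by omega, val_div_lt w.2 b⟩, _, hmeet z hz w hadj hwJ, rfl⟩

theorem chain_columns (hn : 5 ≤ n) (l : ℕ) :
    Relation.ReflTransGen ((cyclicLatinGraph n).MergeStep (4 * n - 8)) ⊥
      (kerPartition fun v : ZMod n × ZMod n => (v.1.val / 2, v.2.val / 2 ^ (l + 1))) := by
  induction l with
  | zero =>
    have h := (chain_pair_columns hn).trans (chain_pair_rows hn)
    rwa [kerPartition_eq_bot Function.injective_id] at h
  | succ l ih =>
    have hb : 2 ≤ 2 ^ (l + 1) := by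
      rw [pow_succ]
      have := Nat.one_le_two_pow (n := l)
      omega
    have h := ih.trans (chain_double_columns hn hb)
    simpa only [Nat.div_div_eq_div_mul, ← pow_succ] using h

theorem twinWidth_cyclicLatinGraph_le (hn : 5 ≤ n) :
    (cyclicLatinGraph n).twinWidth ≤ 4 * n - 8 := by
  -- Since `2 ^ (n + 1) > n`, all columns now form one group, and the few remaining row pairs can be
  -- merged freely.
  refine SimpleGraph.twinWidth_le_of_chain ((chain_columns hn n).trans
    (SimpleGraph.chain_of_card_image_le (g := fun _ => ()) (fun _ _ => rfl) ?_))
    (card_parts_kerPartition_le_one fun _ _ => rfl)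
  have hsub : (univ.image fun v : ZMod n × ZMod n => (v.1.val / 2, v.2.val / 2 ^ (n + 1))) ⊆
      range ((n - 1) / 2 + 1) ×ˢ {0} := by
    intro k hk
    obtain ⟨v, -, rfl⟩ := mem_image.1 hk
    refine mem_product.2 ⟨mem_range.2 (val_div_lt v.1 2), mem_singleton.2 (Nat.div_eq_of_lt ?_)⟩
    exact (v.2.val_lt.trans n.lt_two_pow_self).trans_le
      (Nat.pow_le_pow_right two_pos (Nat.le_succ n))
  refine (card_le_card hsub).trans ?_
  rw [card_product, card_range, card_singleton]
  omega

end Doubling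

/-! ### Comparison of the two bounds -/

theorem mainTheorem5 (n : ℕ) [NeZero n] :
    (LatinSquare.ofAddGroup (ZMod n)).graph.IsLb1Collapsible ∧
      (n = 4 → (LatinSquare.ofAddGroup (ZMod n)).graph.twinWidth = 6) ∧
      (5 ≤ n → (LatinSquare.ofAddGroup (ZMod n)).graph.twinWidth = 4 * n - 8) := by
  have hle := SimpleGraph.lb1_le_twinWidth (cyclicLatinGraph n)
  have hlb : 2 ≤ n → _ := le_lb1_cyclicLatinGraph (n := n)
  have hn : n ≠ 0 := NeZero.ne n
  have hupper : (n ≤ 3 → (cyclicLatinGraph n).twinWidth ≤ 0) ∧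
      (n = 4 → (cyclicLatinGraph n).twinWidth ≤ 6) := by
    constructor
    · intro h
      obtain rfl | rfl | rfl : n = 1 ∨ n = 2 ∨ n = 3 := by omega
      · convert twinWidth_cyclicLatinGraph_one_le
      · convert twinWidth_cyclicLatinGraph_two_le
      · convert twinWidth_cyclicLatinGraph_three_le
    · rintro rfl
      convert twinWidth_cyclicLatinGraph_four_le
  have hlarge : 5 ≤ n → (cyclicLatinGraph n).twinWidth ≤ 4 * n - 8 :=
    twinWidth_cyclicLatinGraph_le
  change (cyclicLatinGraph n).twinWidth = (cyclicLatinGraph n).lb1 ∧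
    (n = 4 → (cyclicLatinGraph n).twinWidth = 6) ∧
    (5 ≤ n → (cyclicLatinGraph n).twinWidth = 4 * n - 8)
  refine ⟨?_, ?_, ?_⟩
  · rcases lt_or_ge n 4 with h | h
    · have := hupper.1 (by omega)
      omega
    · have := hlb (by omega)
      rcases h.eq_or_lt with h | h
      · have := hupper.2 h.symm
        omega
      · have := hlarge h
        omega
  · intro h
    have := hlb (by omega)
    have := hupper.2 h
    omega
  · intro h
    have := hlb (by omega)
    have := hlarge h
    omega
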